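/- Arithmetic regularity lemma for $U^3$, II. Write $G=\mathbb{F}_5^n$ and $\mathbb{E}_{x\in X}g(x)=|X|^{-1}\sum_{x\in X}g(x)$ for a finite nonempty set $X$. For $g:G\to\mathbb{R}$ put $\|g\|_2=(\mathbb{E}_{x\in G}\,g(x)^2)^{1/2}$ and $$\|g\|_{U^3}=\Big(\mathbb{E}_{x,h_1,h_2,h_3\in G}\ \prod_{\epsilon\in\{0,1\}^3}g(x+\epsilon_1h_1+\epsilon_2h_2+\epsilon_3h_3)\Big)^{1/8}.$$ A (homogeneous) quadratic factor of complexity $(d_1,d_2)$ on $G$ is given by vectors $r_1,\dots,r_{d_1}\in\mathbb{F}_5^n$ and symmetric $n\times n$ matrices $M_1,\dots,M_{d_2}$ over $\mathbb{F}_5$, where $d_1,d_2\ge 0$. It is the pair $(\mathcal{B}_1,\mathcal{B}_2)$ of $\sigma$-algebras on $G$ in which $\mathcal{B}_1$ is generated by the functions $x\mapsto r_j^Tx$, and $\mathcal{B}_2$ by these together with the functions $x\mapsto x^TM_jx$; the atoms are the nonempty joint level sets of the generating functions. The factor $(\mathcal{B}_1,\mathcal{B}_2)$ refines $(\mathcal{B}_1',\mathcal{B}_2')$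 if, for $i=1,2$, every atom of $\mathcal{B}_i$ is contained in an atom of $\mathcal{B}_i'$. It has rank at least $t$ if $\operatorname{rk}(\lambda_1M_1+\dots+\lambda_{d_2}M_{d_2})\ge t$ whenever $\lambda_1,\dots,\lambda_{d_2}\in\mathbb{F}_5$ are not all zero. Finally, $\mathbb{E}(f|\mathcal{B}_2)(x)$ is the average of $f$ over the atom of $\mathcal{B}_2$ containing $x$. Proposition. Let $\delta>0$ and let $\omega_1,\omega_2:[0,\infty)\to(0,\infty)$ be arbitrary functions (in applications, rapidly growing ones). Then there are $n_0=n_0(\delta,\omega_1,\omega_2)$ and a function $C=C_{\delta,\omega_1,\omega_2}:\mathbb{N}\times\mathbb{N}\to\mathbb{N}$ with the following property. Let $n>n_0$, let $f:\mathbb{F}_5^n\to[-1,1]$ be a function, and let $(\mathcal{B}^{(0)}_1,\mathcal{B}^{(0)}_2)$ be a quadratic factor of complexity $(d_1^{(0)},d_2^{(0)})$ on $\mathbb{F}_5^n$. Then there is a quadratic factor $(\mathcal{B}_1,\mathcal{B}_2)$ on $\mathbb{F}_5^n$, of some complexity $(d_1,d_2)$, such that 1. $(\mathcal{B}_1,\mathcal{B}_2)$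 refines $(\mathcal{B}^{(0)}_1,\mathcal{B}^{(0)}_2)$; 2. $d_1,d_2\le C(d_1^{(0)},d_2^{(0)})$; 3. the rank of $(\mathcal{B}_1,\mathcal{B}_2)$ is at least $\omega_1(d_1+d_2)$; 4. there is a decomposition $f=f_1+f_2+f_3$ with $f_1=\mathbb{E}(f|\mathcal{B}_2)$, $\|f_2\|_2\le\delta$ and $\|f_3\|_{U^3}\le 1/\omega_2(d_1+d_2)$. -/

import Mathlib

open scoped BigOperators NNReal

noncomputable section

/-- The group `G = 𝔽₅ⁿ`. -/
abbrev F5n (n : ℕ) : Type := Fin n → ZMod 5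

/-- The norm `‖f‖₂ = (𝔼_x f(x)²)^{1/2}` with respect to the normalised counting measure. -/
def l2Norm {n : ℕ} (f : F5n n → ℝ) : ℝ :=
  Real.sqrt (𝔼 x, f x ^ 2)

/-- The average of `f` over 3-dimensional parallelepipeds, that is `‖f‖_{U³}⁸`. -/
def gowersU3Pow {n : ℕ} (f : F5n n → ℝ) : ℝ :=
  𝔼 x, 𝔼 h₁, 𝔼 h₂, 𝔼 h₃,
    f x * f (x + h₁) * f (x + h₂) * f (x + h₃) *
      f (x + h₁ + h₂) * f (x + h₁ + h₃) * f (x + h₂ + h₃) * f (x + h₁ + h₂ + h₃)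

/-- The average over parallelepipeds is nonnegative, so that its eighth root makes sense. -/
theorem gowersU3Pow_nonneg {n : ℕ} (f : F5n n → ℝ) : 0 ≤ gowersU3Pow f := by
  have key : gowersU3Pow f =
      𝔼 h₁, 𝔼 h₂, (𝔼 x, f x * f (x + h₁) * f (x + h₂) * f (x + h₁ + h₂)) ^ 2 := by
    unfold gowersU3Pow
    rw [Finset.expect_comm]
    refine Finset.expect_congr rfl fun h₁ _ => ?_
    rw [Finset.expect_comm]
    refine Finset.expect_congr rfl fun h₂ _ => ?_
    rw [sq, Finset.expect_mul]
    refine Finset.expect_congr rfl fun x _ => ?_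
    rw [Finset.mul_expect]
    refine Fintype.expect_equiv (Equiv.addLeft x) _ _ fun h₃ => ?_
    simp only [Equiv.coe_addLeft]
    rw [add_right_comm x h₃ h₁, add_right_comm x h₃ h₂, add_right_comm (x + h₁) h₃ h₂]
    ring
  rw [key]
  exact Finset.expect_nonneg fun _ _ => Finset.expect_nonneg fun _ _ => sq_nonneg _

/-- The Gowers norm `‖f‖_{U³}`. -/
def gowersU3Norm {n : ℕ} (f : F5n n → ℝ) : ℝ :=
  gowersU3Pow f ^ ((1 : ℝ) / 8)

/-- The conditional expectation `𝔼(f | B)`: its value at `x` is the average of `f` over the atom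
of `B` that contains `x`. A σ-algebra on the finite set `𝔽₅ⁿ` is given by its partition into
atoms, that is, by the equivalence relation of lying in the same atom. -/
def condAvg {n : ℕ} (B : Setoid (F5n n)) (f : F5n n → ℝ) (x : F5n n) : ℝ :=
  open Classical in 𝔼 y ∈ Finset.univ.filter (fun y => B x y), f y

/-- The data of a (homogeneous) quadratic factor of complexity `(d₁, d₂)`: vectors
`r₁, …, r_{d₁}` and symmetric matrices `M₁, …, M_{d₂}` over `𝔽₅`. -/
structure QuadraticFactor (n d₁ d₂ : ℕ) where
  /-- the vectors `r_j` -/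
  r : Fin d₁ → F5n n
  /-- the matrices `M_j` -/
  M : Fin d₂ → Matrix (Fin n) (Fin n) (ZMod 5)
  /-- the matrices `M_j` are symmetric -/
  symm : ∀ j, (M j).IsSymm

namespace QuadraticFactor

variable {n d₁ d₂ e₁ e₂ : ℕ}

/-- The map `Γ(x) = (r₁ᵀx, …, r_{d₁}ᵀx)`. -/
def linMap (Q : QuadraticFactor n d₁ d₂) (x : F5n n) : Fin d₁ → ZMod 5 :=
  fun j => Q.r j ⬝ᵥ x

/-- The map `Φ(x) = (xᵀM₁x, …, xᵀM_{d₂}x)`. -/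
def quadMap (Q : QuadraticFactor n d₁ d₂) (x : F5n n) : Fin d₂ → ZMod 5 :=
  fun j => x ⬝ᵥ (Q.M j).mulVec x

/-- The linear factor `B₁`, whose atoms are the level sets of `Γ`. -/
def B₁ (Q : QuadraticFactor n d₁ d₂) : Setoid (F5n n) :=
  Setoid.ker Q.linMap

/-- The factor `B₂`, whose atoms are the level sets of `(Γ, Φ)`. -/
def B₂ (Q : QuadraticFactor n d₁ d₂) : Setoid (F5n n) :=
  Setoid.ker fun x => (Q.linMap x, Q.quadMap x)

/-- `Q` refines `Q'`: every atom of `B₁`, respectively `B₂`, of `Q` is contained in an atom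
of the corresponding factor of `Q'`. -/
def Refines (Q : QuadraticFactor n d₁ d₂) (Q' : QuadraticFactor n e₁ e₂) : Prop :=
  Q.B₁ ≤ Q'.B₁ ∧ Q.B₂ ≤ Q'.B₂

/-- `Q` has rank at least `t`: each nontrivial linear combination of the `M_j` has rank at
least `t`. -/
def RankAtLeast (Q : QuadraticFactor n d₁ d₂) (t : ℝ) : Prop :=
  ∀ c : Fin d₂ → ZMod 5, c ≠ 0 → t ≤ ((∑ j, c j • Q.M j).rank : ℝ)

end QuadraticFactor

end

noncomputable section

/-! The engine is energy increment. The energy of a factor is the mean square of `𝔼(f | B₂)`. It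
lies in [0, 1], grows under refinement, and by Pythagoras its growth is the squared L² distance
between the two projections. If `f - 𝔼(f | B₂)` has large U³ norm, the inverse theorem
`inverse_gowersU3` gives a quadratic phase correlating with it; adjoining the matrix and vector of
that phase raises the energy by a fixed amount. Boundedly many additions therefore make the U³ error
as small as prescribed (`exists_refines_gowersU3Norm_le`).

The strong form compares a high-rank factor Q₀ with such a refinement Q', whose U³ tolerance is set
by the complexity of Q₀. If the two projections are within δ in L², then Q₀ itself is the answer,
with f₂ the difference of the projections. Otherwise the energy has risen by more than δ²; Q' is
refined to high rank and the step repeats, boundedly often in terms of δ. High rank is obtained in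
`exists_refines_of_combination`: a low-rank combination is determined by the linear forms in its row
space, so one matrix is exchanged for few vectors.

For the inverse theorem, large U³ norm makes many derivatives of f have a large Fourier coefficient
at some φ(h). Cauchy–Schwarz gives the graph of φ large additive energy, and Balog–Szemerédi–Gowers
with Freiman makes φ affine, h ↦ Th + b, on a dense set. A symmetry argument bounds the range of Tᵀ
- T, so pigeonholing replaces T by a symmetric matrix, and a symmetric derivative integrates to a
quadratic phase. -/

/-- The difference convolution of `F` with itself. -/
def diffConv {G : Type*} [AddCommGroup G] [Fintype G] (F : G → ℝ) (d : G) : ℝ :=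
  ∑ u, F u * F (u - d)

/-! ### Additive energy and the Balog–Szemerédi–Gowers theorem -/

section BalogSzemerediGowers

variable {G : Type*} [AddCommGroup G] [Fintype G]

theorem sum_diffConv (F : G → ℝ) : ∑ d, diffConv F d = (∑ u, F u) ^ 2 := by
  unfold diffConv
  rw [Finset.sum_comm, sq, Finset.sum_mul]
  refine Finset.sum_congr rfl fun u _ => ?_
  rw [← Finset.mul_sum]
  congr 1
  exact Fintype.sum_equiv (Equiv.subLeft u) _ _ fun d => rfl

theorem diffConv_nonneg {F : G → ℝ} (hF : ∀ u, 0 ≤ F u) (d : G) : 0 ≤ diffConv F d :=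
  Finset.sum_nonneg fun _ _ => mul_nonneg (hF _) (hF _)

/-- Each c in S yields a representation a - a' = (a - c) - (a' - c) of weight at least τ². Iterating
this turns paths in a graph of differences into representations. -/
theorem card_mul_sq_le_diffConv {F : G → ℝ} (hF : ∀ u, 0 ≤ F u) (S : Finset G) {a a' : G} {τ : ℝ}
    (hτ : 0 ≤ τ) (h : ∀ c ∈ S, τ ≤ F (a - c) ∧ τ ≤ F (a' - c)) :
    S.card * τ ^ 2 ≤ diffConv F (a - a') := by
  unfold diffConv
  calc S.card * τ ^ 2 = ∑ _c ∈ S, τ ^ 2 := by simp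
    _ ≤ ∑ c ∈ S, F (a - c) * F (a' - c) := by
        refine Finset.sum_le_sum fun c hc => ?_
        rw [sq]
        exact mul_le_mul (h c hc).1 (h c hc).2 hτ (hF _)
    _ ≤ ∑ c, F (a - c) * F (a' - c) :=
        Finset.sum_le_sum_of_subset_of_nonneg (Finset.subset_univ _)
          fun _ _ _ => mul_nonneg (hF _) (hF _)
    _ = ∑ u, F u * F (u - (a - a')) := by
        refine Fintype.sum_equiv (Equiv.subLeft a) _ _ fun c => ?_
        simp only [Equiv.subLeft_apply]
        congr 2
        abel

open Classical in
/-- Dependent random choice: a dense bipartite graph on `Γ × Γ` contains a large set of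
vertices any two of which are joined by many paths of length four. -/
theorem exists_subset_many_paths {V : Type*} (Γ : Finset V) (R : V → V → Prop) {α : ℝ}
    (hα : 0 < α) (hΓ : Γ.Nonempty)
    (hR : α * (Γ.card : ℝ) ^ 2 ≤ ∑ b ∈ Γ, ((Γ.filter fun a => R a b).card : ℝ)) :
    ∃ B ⊆ Γ, α * Γ.card / 4 ≤ B.card ∧ ∀ a ∈ B, ∀ a' ∈ B,
      α * Γ.card / 4 ≤ ((Γ.filter fun z =>
        α ^ 2 / 32 * Γ.card ≤ (Γ.filter fun c => R a c ∧ R z c).card ∧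
        α ^ 2 / 32 * Γ.card ≤ (Γ.filter fun c => R a' c ∧ R z c).card).card : ℝ) := by
  set m : ℝ := (Γ.card : ℝ) with hm
  have hm0 : 0 < m := by rw [hm]; exact_mod_cast hΓ.card_pos
  clear_value m
  set N : V → Finset V := fun b => Γ.filter fun a => R a b with hN
  set cd : V → V → ℝ := fun a z => ((Γ.filter fun c => R a c ∧ R z c).card : ℝ) with hcd
  -- A pair with few common neighbours lies in N(b) × N(b) for few b, so a random neighbourhood
  -- contains few bad pairs.
  set bad : V → V → Prop := fun a z => cd a z < α ^ 2 / 32 * m with hbad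
  set nb : V → ℝ := fun b => ∑ a ∈ N b, (((N b).filter fun z => bad a z).card : ℝ) with hnb
  have cs : α ^ 2 * m ^ 3 ≤ ∑ b ∈ Γ, ((N b).card : ℝ) ^ 2 := by
    have h1 := sq_sum_le_card_mul_sum_sq (s := Γ) (f := fun b => ((N b).card : ℝ))
    rw [← hm] at h1
    have h2 : (α * m ^ 2) ^ 2 ≤ (∑ b ∈ Γ, ((N b).card : ℝ)) ^ 2 :=
      pow_le_pow_left₀ (by positivity) hR 2
    have h3 : m * (α ^ 2 * m ^ 3) ≤ m * ∑ b ∈ Γ, ((N b).card : ℝ) ^ 2 := by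
      calc _ = (α * m ^ 2) ^ 2 := by ring
        _ ≤ _ := h2.trans h1
    exact le_of_mul_le_mul_left h3 hm0
  have hbadsum : ∑ b ∈ Γ, nb b ≤ α ^ 2 / 32 * m ^ 3 := by
    have e1 : ∀ b, nb b = ∑ a ∈ Γ, ∑ z ∈ Γ,
        if (bad a z) then (if R a b ∧ R z b then (1 : ℝ) else 0) else 0 := by
      intro b
      simp only [hnb, hN, Finset.sum_filter, Finset.card_filter, Nat.cast_sum]
      refine Finset.sum_congr rfl fun a _ => ?_
      split_ifs with h
      · refine Finset.sum_congr rfl fun z _ => ?_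
        by_cases h1 : R z b <;> by_cases h2 : bad a z <;> simp [h1, h2, h]
      · simp [h]
    simp only [e1]
    rw [Finset.sum_comm]
    have : ∀ a ∈ Γ, ∑ b ∈ Γ, ∑ z ∈ Γ,
        (if (bad a z) then (if R a b ∧ R z b then (1 : ℝ) else 0) else 0) ≤
        m * (α ^ 2 / 32 * m) := by
      intro a _
      rw [Finset.sum_comm]
      calc _ ≤ ∑ z ∈ Γ, α ^ 2 / 32 * m := by
            refine Finset.sum_le_sum fun z _ => ?_
            by_cases h : bad a z
            · simp only [h, if_true]
              have h' : cd a z ≤ α ^ 2 / 32 * m := le_of_lt h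
              rw [Finset.sum_boole]
              exact h'
            · simp only [h, if_false, Finset.sum_const_zero]
              positivity
        _ = _ := by rw [Finset.sum_const, nsmul_eq_mul, hm]
    calc _ ≤ ∑ a ∈ Γ, m * (α ^ 2 / 32 * m) := Finset.sum_le_sum this
      _ = _ := by rw [Finset.sum_const, nsmul_eq_mul, ← hm]; ring
  -- The weight 16 costs only half of the main term and leaves at most s²/16 bad pairs in N(b),
  -- where s = |N(b)|.
  obtain ⟨b, hb, hbb⟩ : ∃ b ∈ Γ, α ^ 2 / 2 * m ^ 2 ≤ ((N b).card : ℝ) ^ 2 - 16 * nb b := by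
    refine Finset.exists_le_of_sum_le hΓ ?_
    have e : ∑ x ∈ Γ, 16 * nb x = 16 * ∑ x ∈ Γ, nb x := (Finset.mul_sum _ _ _).symm
    rw [Finset.sum_sub_distrib, e, Finset.sum_const, nsmul_eq_mul, ← hm]
    linarith
  have hNb : N b ⊆ Γ := Finset.filter_subset _ _
  set s : ℝ := ((N b).card : ℝ) with hs
  have hs0 : 0 ≤ s := Nat.cast_nonneg _
  have hnb0 : 0 ≤ nb b := Finset.sum_nonneg fun _ _ => Nat.cast_nonneg _
  have hslow : α * m / 2 ≤ s := by
    refine le_of_sq_le_sq ?_ hs0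
    nlinarith [mul_pos hα hm0]
  have hnbup : nb b ≤ s ^ 2 / 16 := by nlinarith [sq_nonneg (α * m)]
  have hspos : 0 < s := lt_of_lt_of_le (by positivity) hslow
  set badN : V → Finset V := fun a => (N b).filter fun z => bad a z with hbadN
  -- By Markov at most s/4 vertices are discarded. Any two that remain share at least s - s/4 - s/4
  -- = s/2 ≥ αm/4 good partners in N(b).
  set B := (N b).filter fun a => ((badN a).card : ℝ) ≤ s / 4 with hB
  clear_value s
  have hBN : B ⊆ N b := Finset.filter_subset _ _
  have hcompl : ((N b \ B).card : ℝ) * (s / 4) ≤ nb b := by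
    calc ((N b \ B).card : ℝ) * (s / 4) = ∑ _a ∈ N b \ B, s / 4 := by rw [Finset.sum_const, nsmul_eq_mul]
      _ ≤ ∑ a ∈ N b \ B, ((badN a).card : ℝ) := by
          refine Finset.sum_le_sum fun a ha => ?_
          rw [Finset.mem_sdiff] at ha
          by_contra hcon
          exact ha.2 (Finset.mem_filter.2 ⟨ha.1, le_of_not_ge hcon⟩)
      _ ≤ nb b := Finset.sum_le_sum_of_subset_of_nonneg Finset.sdiff_subset
          fun _ _ _ => Nat.cast_nonneg _
  have hcompl' : ((N b \ B).card : ℝ) ≤ s / 4 := by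
    by_contra hcon
    push Not at hcon
    nlinarith
  have hBcard : s * (3 / 4) ≤ B.card := by
    have := Finset.card_sdiff_add_card_eq_card hBN
    have : ((N b \ B).card : ℝ) + B.card = s := by rw [hs]; exact_mod_cast this
    linarith
  refine ⟨B, hBN.trans hNb, by linarith [mul_pos hα hm0], fun a ha a' ha' => ?_⟩
  have hba : ((badN a).card : ℝ) ≤ s / 4 := (Finset.mem_filter.1 ha).2
  have hba' : ((badN a').card : ℝ) ≤ s / 4 := (Finset.mem_filter.1 ha').2
  have hsub : N b \ (badN a ∪ badN a') ⊆ Γ.filter fun z =>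
        α ^ 2 / 32 * m ≤ (Γ.filter fun c => R a c ∧ R z c).card ∧
        α ^ 2 / 32 * m ≤ (Γ.filter fun c => R a' c ∧ R z c).card := by
    intro z hz
    rw [Finset.mem_sdiff, Finset.mem_union, not_or] at hz
    obtain ⟨hz, h1, h2⟩ := hz
    rw [Finset.mem_filter]
    refine ⟨hNb hz, ?_, ?_⟩
    · by_contra h
      exact h1 (Finset.mem_filter.2 ⟨hz, lt_of_not_ge h⟩)
    · by_contra h
      exact h2 (Finset.mem_filter.2 ⟨hz, lt_of_not_ge h⟩)
  have hc : s ≤ ((N b \ (badN a ∪ badN a')).card : ℝ) + ((badN a).card + (badN a').card) := by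
    have h1 := Finset.card_le_card_sdiff_add_card (s := N b) (t := badN a ∪ badN a')
    have h2 := Finset.card_union_le (badN a) (badN a')
    rw [hs]
    exact_mod_cast h1.trans (Nat.add_le_add_left h2 _)
  have := Finset.card_le_card hsub
  have : ((N b \ (badN a ∪ badN a')).card : ℝ) ≤ _ := Nat.cast_le.2 this
  linarith

open Classical Pointwise in
/-- The **Balog–Szemerédi–Gowers theorem**. -/
theorem balog_szemeredi_gowers {α : ℝ} (hα : 0 < α) (Γ : Finset G) (hΓ : Γ.Nonempty)
    (hE : 2 * α * (Γ.card : ℝ) ^ 3 ≤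
      ∑ d, diffConv (fun x => if x ∈ Γ then (1 : ℝ) else 0) d ^ 2) :
    ∃ B ⊆ Γ, α / 4 * Γ.card ≤ B.card ∧ ((B - B).card : ℝ) ≤ 2 ^ 14 / α ^ 10 * B.card := by
  set m : ℝ := (Γ.card : ℝ) with hm
  have hm0 : 0 < m := by rw [hm]; exact_mod_cast hΓ.card_pos
  clear_value m
  set F : G → ℝ := fun x => if x ∈ Γ then (1 : ℝ) else 0 with hF
  have hF0 : ∀ u, 0 ≤ F u := fun u => by simp only [hF]; split_ifs <;> norm_num
  have hsumF : ∑ u, F u = m := by simp [hF, hm]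
  set r := diffConv F with hr
  have hr0 : ∀ d, 0 ≤ r d := diffConv_nonneg hF0
  have hsumr : ∑ d, r d = m ^ 2 := by rw [hr, sum_diffConv, hsumF]
  have hrm : ∀ d, r d ≤ m := by
    intro d
    rw [← hsumF]
    refine Finset.sum_le_sum fun u _ => ?_
    simp only [hF]
    split_ifs <;> norm_num
  -- Popular differences. The unpopular ones carry at most half of the energy 2αm³.
  set P : Finset G := Finset.univ.filter fun d => α * m ≤ r d with hP
  have h1 : α * m ^ 3 ≤ ∑ d ∈ P, r d ^ 2 := by
    have h2 := Finset.sum_filter_add_sum_filter_not Finset.univ (fun d => α * m ≤ r d)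
      (fun d => r d ^ 2)
    have h3 : ∑ d ∈ Finset.univ.filter (fun d => ¬ α * m ≤ r d), r d ^ 2 ≤ α * m * m ^ 2 := by
      calc _ ≤ ∑ d ∈ Finset.univ.filter (fun d => ¬ α * m ≤ r d), α * m * r d := by
            refine Finset.sum_le_sum fun d hd => ?_
            have := (Finset.mem_filter.1 hd).2
            rw [sq]
            exact mul_le_mul_of_nonneg_right (le_of_not_ge this) (hr0 d)
        _ ≤ ∑ d, α * m * r d := Finset.sum_le_sum_of_subset_of_nonneg (Finset.subset_univ _)
            fun d _ _ => mul_nonneg (by positivity) (hr0 d)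
        _ = _ := by rw [← Finset.mul_sum, hsumr]
    rw [hP]
    nlinarith
  have h2 : α * m ^ 2 ≤ ∑ d ∈ P, r d := by
    have h3 : ∑ d ∈ P, r d ^ 2 ≤ m * ∑ d ∈ P, r d := by
      rw [Finset.mul_sum]
      refine Finset.sum_le_sum fun d _ => ?_
      rw [sq]
      exact mul_le_mul_of_nonneg_right (hrm d) (hr0 d)
    have h4 : m * (α * m ^ 2) ≤ m * ∑ d ∈ P, r d := by
      calc _ = α * m ^ 3 := by ring
        _ ≤ _ := h1.trans h3
    exact le_of_mul_le_mul_left h4 hm0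
  have h3 : ∑ d ∈ P, r d = ∑ b ∈ Γ, ((Γ.filter fun a => a - b ∈ P).card : ℝ) := by
    have e1 : ∀ b, ((Γ.filter fun a => a - b ∈ P).card : ℝ) = ∑ d ∈ P, F (b + d) := by
      intro b
      simp only [hF, Finset.sum_boole]
      congr 1
      refine Finset.card_bij (fun a _ => a - b) ?_ ?_ ?_
      · intro a ha
        simpa [and_comm] using ha
      · intro a _ a' _ h
        simpa using h
      · intro d hd
        rw [Finset.mem_filter] at hd
        exact ⟨b + d, by simp [hd.1, hd.2], by simp⟩
    have e2 : ∀ d, r d = ∑ b ∈ Γ, F (b + d) := by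
      intro d
      have : ∑ b ∈ Γ, F (b + d) = ∑ b, F (b + d) * F b := by
        simp [hF]
      rw [this]
      exact (Fintype.sum_equiv (Equiv.addRight d) _ _ fun b => by simp).symm
    simp only [e1, e2]
    rw [Finset.sum_comm]
  obtain ⟨B, hBΓ, hBc, hB⟩ := exists_subset_many_paths Γ (fun a b => a - b ∈ P) hα hΓ
    (by rw [h3] at h2; rw [← hm]; convert h2)
  rw [← hm] at hBc hB
  refine ⟨B, hBΓ, by linarith, ?_⟩
  have hpath : ∀ a z, α ^ 2 / 32 * m ≤ (Γ.filter fun c => a - c ∈ P ∧ z - c ∈ P).card →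
      α ^ 4 / 32 * m ^ 3 ≤ diffConv r (a - z) := by
    intro a z h
    have h4 := card_mul_sq_le_diffConv hr0 (Γ.filter fun c => a - c ∈ P ∧ z - c ∈ P)
      (a := a) (a' := z) (τ := α * m) (by positivity) fun c hc => by
        have := (Finset.mem_filter.1 hc).2
        exact ⟨(Finset.mem_filter.1 this.1).2, (Finset.mem_filter.1 this.2).2⟩
    calc _ = α ^ 2 / 32 * m * (α * m) ^ 2 := by ring
      _ ≤ _ := mul_le_mul_of_nonneg_right h (by positivity)
      _ ≤ _ := h4
  have hr2 : ∀ d, 0 ≤ diffConv r d := diffConv_nonneg hr0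
  -- Counts representations of d by eight elements of Γ: αm/4 choices of the midpoint z, and α⁴m³/32
  -- for each half of the path. Only m⁸ octuples are available, which bounds |B - B|.
  have hlow : ∀ d ∈ B - B, α ^ 9 / 2 ^ 12 * m ^ 7 ≤ diffConv (diffConv r) d := by
    intro d hd
    obtain ⟨a, ha, a', ha', rfl⟩ := Finset.mem_sub.1 hd
    have h4 := card_mul_sq_le_diffConv hr2 (a := a) (a' := a') (τ := α ^ 4 / 32 * m ^ 3)
      (hτ := by positivity) (S := Γ.filter fun z =>
        α ^ 2 / 32 * m ≤ (Γ.filter fun c => a - c ∈ P ∧ z - c ∈ P).card ∧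
        α ^ 2 / 32 * m ≤ (Γ.filter fun c => a' - c ∈ P ∧ z - c ∈ P).card) fun z hz => by
          have := (Finset.mem_filter.1 hz).2
          exact ⟨hpath _ _ this.1, hpath _ _ this.2⟩
    calc _ = α * m / 4 * (α ^ 4 / 32 * m ^ 3) ^ 2 := by ring
      _ ≤ _ := mul_le_mul_of_nonneg_right (hB a ha a' ha') (by positivity)
      _ ≤ _ := by convert h4
  have hupp : ((B - B).card : ℝ) * (α ^ 9 / 2 ^ 12 * m ^ 7) ≤ m ^ 8 := by
    calc _ = ∑ _d ∈ B - B, α ^ 9 / 2 ^ 12 * m ^ 7 := by rw [Finset.sum_const, nsmul_eq_mul]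
      _ ≤ ∑ d ∈ B - B, diffConv (diffConv r) d := Finset.sum_le_sum hlow
      _ ≤ ∑ d, diffConv (diffConv r) d := Finset.sum_le_sum_of_subset_of_nonneg
          (Finset.subset_univ _) fun _ _ _ => diffConv_nonneg hr2 _
      _ = m ^ 8 := by rw [sum_diffConv, sum_diffConv, hsumr]; ring
  have h5 : ((B - B).card : ℝ) * (α ^ 9 / 2 ^ 12) ≤ m := by
    refine le_of_mul_le_mul_right ?_ (pow_pos hm0 7)
    calc _ = ((B - B).card : ℝ) * (α ^ 9 / 2 ^ 12 * m ^ 7) := by ring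
      _ ≤ m ^ 8 := hupp
      _ = _ := by ring
  rw [div_mul_eq_mul_div, le_div_iff₀ (by positivity)]
  calc ((B - B).card : ℝ) * α ^ 10 = 2 ^ 12 * α * (((B - B).card : ℝ) * (α ^ 9 / 2 ^ 12)) := by ring
    _ ≤ 2 ^ 12 * α * m := by gcongr
    _ ≤ 2 ^ 14 * B.card := by linarith

end BalogSzemerediGowers

instance fact_prime_five : Fact (Nat.Prime 5) := ⟨by norm_num⟩

/-! ### Freiman's theorem and affine structure of graphs -/

section Freiman

open Classical Pointwise in
/-- **Freiman's theorem** in a vector space over `𝔽₅`: a set of small doubling lies in a coset of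
a subspace that is not much larger. -/
theorem exists_submodule_of_small_doubling {W : Type*} [AddCommGroup W] [Module (ZMod 5) W]
    [Finite W] {K : ℝ} (B : Finset W) (hB : B.Nonempty) (hK : ((B - B).card : ℝ) ≤ K * B.card) :
    ∃ H : Submodule (ZMod 5) W, (∀ x ∈ B, ∀ y ∈ B, x - y ∈ H) ∧
      (Nat.card H : ℝ) ≤ 5 ^ ⌊K ^ 5⌋₊ * K * B.card := by
  have hB0 : (0 : ℝ) < B.card := by exact_mod_cast hB.card_pos
  have hpl : (((B - B) + (B - B) + B).card : ℝ) ≤ K ^ 5 * B.card := by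
    have h1 := Finset.pluennecke_ruzsa_inequality_nsmul_sub_nsmul_sub hB B 3 2
    have h2 : ((3 • B - 2 • B).card : ℝ) ≤ (((B - B).card : ℝ) / B.card) ^ (3 + 2) * B.card := by
      have h2 := (NNRat.cast_le (K := ℝ)).2 h1
      push_cast at h2
      exact h2
    have h3 : (B - B) + (B - B) + B = 3 • B - 2 • B := by
      rw [succ_nsmul B 2, two_nsmul]
      simp only [sub_eq_add_neg, neg_add]
      ac_rfl
    rw [h3]
    refine h2.trans ?_
    gcongr
    rwa [div_le_iff₀ hB0]
  -- Ruzsa covering gives (B - B) + (B - B) ⊆ F + (B - B). Hence (B - B) + span F is closed under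
  -- addition, and an additive subgroup is already a subspace over the prime field.
  obtain ⟨F, -, hFc, hF⟩ := Finset.ruzsa_covering_add hB hpl
  let S := Submodule.span (ZMod 5) (F : Set W)
  have hadd : ∀ d ∈ B - B, ∀ d' ∈ B - B, ∃ d'' ∈ B - B, ∃ s ∈ S, d + d' = d'' + s := by
    intro d hd d' hd'
    obtain ⟨s, hs, d'', hd'', h⟩ := Finset.mem_add.1 (hF (Finset.add_mem_add hd hd'))
    exact ⟨d'', hd'', s, Submodule.subset_span hs, by rw [← h, add_comm]⟩
  let A : AddSubgroup W :=
    { carrier := {x | ∃ d ∈ B - B, ∃ s ∈ S, x = d + s}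
      zero_mem' := by
        obtain ⟨b, hb⟩ := hB
        exact ⟨0, Finset.mem_sub.2 ⟨b, hb, b, hb, sub_self b⟩, 0, S.zero_mem, by simp⟩
      add_mem' := by
        rintro _ _ ⟨d, hd, s, hs, rfl⟩ ⟨d', hd', s', hs', rfl⟩
        obtain ⟨d'', hd'', t, ht, h⟩ := hadd d hd d' hd'
        exact ⟨d'', hd'', t + (s + s'), S.add_mem ht (S.add_mem hs hs'), by
          rw [add_add_add_comm, h, add_assoc]⟩
      neg_mem' := by
        rintro _ ⟨d, hd, s, hs, rfl⟩
        obtain ⟨x, hx, y, hy, rfl⟩ := Finset.mem_sub.1 hd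
        exact ⟨y - x, Finset.sub_mem_sub hy hx, -s, S.neg_mem hs, by abel⟩ }
  refine ⟨AddSubgroup.toZModSubmodule 5 A, ?_, ?_⟩
  · intro x hx y hy
    exact ⟨x - y, Finset.sub_mem_sub hx hy, 0, S.zero_mem, by simp⟩
  · have hS : (Nat.card S : ℝ) ≤ 5 ^ ⌊K ^ 5⌋₊ := by
      have h1 : Nat.card S = 5 ^ Module.finrank (ZMod 5) S := by
        rw [Module.natCard_eq_pow_finrank (K := ZMod 5), Nat.card_zmod]
      have h2 : Module.finrank (ZMod 5) S ≤ F.card := finrank_span_finset_le_card F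
      rw [h1]
      push_cast
      exact pow_le_pow_right₀ (by norm_num) (h2.trans (Nat.le_floor hFc))
    have hAc : Nat.card A ≤ (B - B).card * Nat.card S := by
      have hsurj : Function.Surjective (fun p : (↥(B - B)) × S =>
          (⟨p.1 + p.2, p.1, p.1.2, p.2, p.2.2, rfl⟩ : A)) := by
        rintro ⟨_, d, hd, s, hs, rfl⟩
        exact ⟨(⟨d, hd⟩, ⟨s, hs⟩), rfl⟩
      have := Nat.card_le_card_of_surjective _ hsurj
      rwa [Nat.card_prod, Nat.card_eq_fintype_card (α := ↥(B - B)), Fintype.card_coe] at this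
    have hAc' : (Nat.card A : ℝ) ≤ (B - B).card * Nat.card S := by exact_mod_cast hAc
    calc (Nat.card (AddSubgroup.toZModSubmodule 5 A) : ℝ) = Nat.card A := rfl
      _ ≤ (B - B).card * Nat.card S := hAc'
      _ ≤ (K * B.card) * 5 ^ ⌊K ^ 5⌋₊ :=
        mul_le_mul hK hS (by positivity) ((Nat.cast_nonneg _).trans hK)
      _ = _ := by ring

/-- A function whose graph has small doubling agrees with an affine map on a large part of
its domain. -/
theorem exists_affine_of_subgraph {V : Type*} [AddCommGroup V] [Module (ZMod 5) V] [Fintype V]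
    [DecidableEq V] (φ : V → V) (A : Finset V) (hA : A.Nonempty) (H : Submodule (ZMod 5) (V × V))
    (hH : ∀ x ∈ A, ∀ y ∈ A, (x, φ x) - (y, φ y) ∈ H) {L : ℝ}
    (hL : (Nat.card H : ℝ) ≤ L * A.card) :
    ∃ (T : V →ₗ[ZMod 5] V) (b : V), A.card ≤ L * (A.filter fun h => φ h = T h + b).card := by
  classical
  obtain ⟨a, ha⟩ := hA
  let π : H →ₗ[ZMod 5] V := LinearMap.fst (ZMod 5) V V ∘ₗ H.subtype
  -- A linear section of the first projection of H, with second coordinate extended to all of V,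
  -- gives T whose graph over that projection lies in H.
  obtain ⟨s, hs⟩ := π.rangeRestrict.exists_rightInverse_of_surjective π.range_rangeRestrict
  obtain ⟨T, hT⟩ := LinearMap.exists_extend (LinearMap.snd (ZMod 5) V V ∘ₗ H.subtype ∘ₗ s)
  have hTH : ∀ p ∈ H, (p.1, T p.1) ∈ H := by
    intro p hp
    have h1 : p.1 ∈ LinearMap.range π := ⟨⟨p, hp⟩, rfl⟩
    have h2 : (s ⟨p.1, h1⟩ : V × V).1 = p.1 := congrArg Subtype.val (LinearMap.congr_fun hs ⟨p.1, h1⟩)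
    have h3 : T p.1 = (s ⟨p.1, h1⟩ : V × V).2 := LinearMap.congr_fun hT ⟨p.1, h1⟩
    have h4 : (p.1, T p.1) = (s ⟨p.1, h1⟩ : V × V) := Prod.ext h2.symm h3
    rw [h4]
    exact (s ⟨p.1, h1⟩).2
  let k : V → V := fun h => φ h - φ a - T (h - a)
  let Z : Finset V := Finset.univ.filter fun v => ((0 : V), v) ∈ H
  have hk : ∀ h ∈ A, k h ∈ Z := by
    intro h hh
    have h1 := hH h hh a ha
    have h2 := H.sub_mem h1 (hTH _ h1)
    rw [Finset.mem_filter]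
    refine ⟨Finset.mem_univ _, ?_⟩
    convert h2 using 1
    simp [k]
  -- The deviations of φ from T lie in the vertical fibre Z of H. Translates of Z over distinct
  -- points of A are disjoint in H, so |Z| ≤ L, and the most frequent deviation gives the affine
  -- map.
  have hZ : Z.card * A.card ≤ Nat.card H := by
    have hinj : Function.Injective (fun p : Z × A =>
        (⟨((p.2 : V) - a, T (p.2 - a) + p.1), by
          have h1 := hTH _ (hH p.2 p.2.2 a ha)
          have h2 := H.add_mem h1 (Finset.mem_filter.1 p.1.2).2
          simpa using h2⟩ : H)) := by
      rintro ⟨⟨z, hz⟩, ⟨h, hh⟩⟩ ⟨⟨z', hz'⟩, ⟨h', hh'⟩⟩ heq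
      have h1 := congrArg Subtype.val heq
      simp only [Prod.mk.injEq, sub_left_inj] at h1
      obtain ⟨rfl, h1⟩ := h1
      simpa using h1
    have := Nat.card_le_card_of_injective _ hinj
    simpa [Nat.card_prod] using this
  have hmaps : A.card = ∑ v ∈ Z, (A.filter fun h => k h = v).card :=
    Finset.card_eq_sum_card_fiberwise hk
  have hA0 : (0 : ℝ) < A.card := by exact_mod_cast Finset.card_pos.2 ⟨a, ha⟩
  have hZL : (Z.card : ℝ) ≤ L := by
    have : (Z.card : ℝ) * A.card ≤ L * A.card := le_trans (by exact_mod_cast hZ) hL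
    exact le_of_mul_le_mul_right this hA0
  have hZn : Z.Nonempty := ⟨_, hk a ha⟩
  obtain ⟨v, -, hv⟩ := Z.exists_max_image (fun v => (A.filter fun h => k h = v).card) hZn
  refine ⟨T, φ a - T a + v, ?_⟩
  have h1 : A.card ≤ Z.card * (A.filter fun h => k h = v).card := by
    rw [hmaps, ← smul_eq_mul]
    exact Finset.sum_le_card_nsmul _ _ _ hv
  have h2 : (A.filter fun h => k h = v) = A.filter fun h => φ h = T h + (φ a - T a + v) := by
    refine Finset.filter_congr fun h _ => ?_
    simp only [k, map_sub]
    constructor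
    · intro e
      rw [← e]
      abel
    · intro e
      rw [e]
      abel
  rw [← h2]
  calc (A.card : ℝ) ≤ Z.card * (A.filter fun h => k h = v).card := by exact_mod_cast h1
    _ ≤ _ := by gcongr

open Classical in
/-- A function whose graph has many additive quadruples agrees with an affine map on a large
part of its domain. -/
theorem exists_affine_of_energy {κ : ℝ} (hκ : 0 < κ) :
    ∃ c : ℝ, 0 < c ∧ ∀ (V : Type) [AddCommGroup V] [Module (ZMod 5) V] [Fintype V]
      (φ : V → V) (A : Finset V), A.Nonempty →
      κ * (A.card : ℝ) ^ 3 ≤ ∑ d : V × V,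
        diffConv (fun x : V × V => if x.1 ∈ A ∧ x.2 = φ x.1 then (1 : ℝ) else 0) d ^ 2 →
      ∃ (T : V →ₗ[ZMod 5] V) (b : V), c * A.card ≤ (A.filter fun h => φ h = T h + b).card := by
  set α := κ / 2 with hα
  have hα0 : 0 < α := by positivity
  set K := 2 ^ 14 / α ^ 10 with hK
  have hK0 : 0 < K := by positivity
  set L := 5 ^ ⌊K ^ 5⌋₊ * K with hL
  have hL0 : 0 < L := by positivity
  refine ⟨α / 4 / L, by positivity, ?_⟩
  intro V _ _ _ φ A hA hE
  set Γ : Finset (V × V) := A.image fun h => (h, φ h) with hΓ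
  have hinj : Function.Injective fun h => (h, φ h) := fun x y h => (Prod.ext_iff.1 h).1
  have hΓc : Γ.card = A.card := Finset.card_image_of_injective _ hinj
  have hmem : ∀ x : V × V, x ∈ Γ ↔ x.1 ∈ A ∧ x.2 = φ x.1 := by
    rintro ⟨x, y⟩
    simp only [hΓ, Finset.mem_image, Prod.mk.injEq]
    constructor
    · rintro ⟨a, ha, rfl, rfl⟩
      exact ⟨ha, rfl⟩
    · rintro ⟨ha, rfl⟩
      exact ⟨x, ha, rfl, rfl⟩
  obtain ⟨B, hBΓ, hBc, hBB⟩ := balog_szemeredi_gowers hα0 Γ (hA.image _) (by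
    rw [hΓc, show 2 * α = κ by rw [hα]; ring]
    simpa only [hmem] using hE)
  have hA0 : (0 : ℝ) < A.card := by exact_mod_cast hA.card_pos
  have hB0 : (0 : ℝ) < B.card := lt_of_lt_of_le (by rw [hΓc]; positivity) hBc
  have hBn : B.Nonempty := Finset.card_pos.1 (by exact_mod_cast hB0)
  obtain ⟨H, hH, hHc⟩ := exists_submodule_of_small_doubling B hBn (by convert hBB)
  set A' : Finset V := B.image Prod.fst with hA'
  have hfst : Set.InjOn Prod.fst (B : Set (V × V)) := by
    intro x hx y hy hxy
    have h1 := (hmem x).1 (hBΓ hx)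
    have h2 := (hmem y).1 (hBΓ hy)
    exact Prod.ext hxy (by rw [h1.2, h2.2, hxy])
  have hA'c : A'.card = B.card := Finset.card_image_of_injOn hfst
  have hA'B : ∀ x ∈ A', (x, φ x) ∈ B := by
    intro x hx
    obtain ⟨p, hp, rfl⟩ := Finset.mem_image.1 hx
    rw [← ((hmem p).1 (hBΓ hp)).2]
    exact hp
  obtain ⟨T, b, hT⟩ := exists_affine_of_subgraph φ A' (hBn.image _) H
    (fun x hx y hy => hH _ (hA'B x hx) _ (hA'B y hy)) (L := L) (by rw [hA'c]; exact hHc)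
  refine ⟨T, b, ?_⟩
  have hsub : (A'.filter fun h => φ h = T h + b) ⊆ A.filter fun h => φ h = T h + b :=
    Finset.filter_subset_filter _ fun x hx => ((hmem _).1 (hBΓ (hA'B x hx))).1
  have h3 : ((A'.filter fun h => φ h = T h + b).card : ℝ) ≤
      (A.filter fun h => φ h = T h + b).card := by exact_mod_cast Finset.card_le_card hsub
  rw [div_mul_eq_mul_div, div_le_iff₀ hL0, mul_comm _ L]
  rw [hΓc] at hBc
  rw [hA'c] at hT
  refine hBc.trans (hT.trans ?_)
  have h3' := mul_le_mul_of_nonneg_left h3 hL0.le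
  convert h3' using 1

end Freiman

/-- The standard additive character `t ↦ exp(2πit/5)` of `𝔽₅`. -/
def ec : AddChar (ZMod 5) ℂ := ZMod.stdAddChar

/-- The Fourier transform on `𝔽₅ⁿ`. -/
def fourierF5 {n : ℕ} (F : F5n n → ℂ) (ξ : F5n n) : ℂ :=
  𝔼 x, F x * ec (-(ξ ⬝ᵥ x))

/-! ### Fourier analysis on 𝔽₅ⁿ and the box norm -/

section Fourier

variable {n : ℕ}

theorem norm_ec (t : ZMod 5) : ‖ec t‖ = 1 := AddChar.norm_apply _ _

theorem conj_ec (t : ZMod 5) : (starRingEnd ℂ) (ec t) = ec (-t) :=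
  (AddChar.map_neg_eq_conj _ _).symm

theorem ec_eq_one_iff (t : ZMod 5) : ec t = 1 ↔ t = 0 := by
  rw [← AddChar.map_zero_eq_one ec]
  exact ZMod.injective_stdAddChar.eq_iff

theorem expect_ec_dotProduct (x : F5n n) : 𝔼 ξ : F5n n, ec (ξ ⬝ᵥ x) = if x = 0 then 1 else 0 := by
  let ψ : AddChar (F5n n) ℂ :=
    ec.compAddMonoidHom ⟨⟨fun ξ => ξ ⬝ᵥ x, zero_dotProduct x⟩, fun a b => add_dotProduct a b x⟩
  have h := AddChar.expect_eq_ite ψ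
  have h0 : ψ = 0 ↔ x = 0 := by
    constructor
    · intro h
      ext i
      have h1 : ec (Pi.single i 1 ⬝ᵥ x) = 1 := DFunLike.congr_fun h (Pi.single i 1)
      simpa [ec_eq_one_iff] using h1
    · rintro rfl
      ext ξ
      simp [ψ]
  simp only [h0] at h
  exact h

theorem sum_ec_dotProduct (x : F5n n) :
    ∑ ξ : F5n n, ec (ξ ⬝ᵥ x) = if x = 0 then (Fintype.card (F5n n) : ℂ) else 0 := by
  rw [← Fintype.card_mul_expect, expect_ec_dotProduct]
  split_ifs <;> simp

theorem fourierF5_inversion (F : F5n n → ℂ) (x : F5n n) :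
    F x = ∑ ξ, fourierF5 F ξ * ec (ξ ⬝ᵥ x) := by
  simp only [fourierF5, Finset.expect_mul]
  rw [← Finset.expect_sum_comm]
  have h : ∀ y, ∑ ξ : F5n n, F y * ec (-(ξ ⬝ᵥ y)) * ec (ξ ⬝ᵥ x) =
      if y = x then F y * (Fintype.card (F5n n) : ℂ) else 0 := by
    intro y
    have h1 : ∀ ξ : F5n n, F y * ec (-(ξ ⬝ᵥ y)) * ec (ξ ⬝ᵥ x) = F y * ec (ξ ⬝ᵥ (x - y)) := by
      intro ξ
      rw [mul_assoc, ← AddChar.map_add_eq_mul, dotProduct_sub, neg_add_eq_sub]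
    simp only [h1, ← Finset.mul_sum, sum_ec_dotProduct, sub_eq_zero, eq_comm (a := x)]
    split_ifs <;> simp
  simp only [h, Fintype.expect_eq_sum_div_card, Finset.sum_ite_eq', Finset.mem_univ, if_true]
  rw [mul_div_cancel_right₀]
  exact_mod_cast Fintype.card_ne_zero

theorem conj_expect {ι : Type*} [Fintype ι] (F : ι → ℂ) :
    (starRingEnd ℂ) (𝔼 x, F x) = 𝔼 x, (starRingEnd ℂ) (F x) := by
  simp [Fintype.expect_eq_sum_div_card]

theorem ofReal_expect {ι : Type*} [Fintype ι] (F : ι → ℝ) :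
    ((𝔼 x, F x : ℝ) : ℂ) = 𝔼 x, (F x : ℂ) := by
  simp [Fintype.expect_eq_sum_div_card]

/-- Parseval's identity, by substituting the inversion formula for one copy of `F`. -/
theorem sum_norm_fourierF5_sq (F : F5n n → ℂ) : ∑ ξ, ‖fourierF5 F ξ‖ ^ 2 = 𝔼 x, ‖F x‖ ^ 2 := by
  have h : ∑ ξ, fourierF5 F ξ * (starRingEnd ℂ) (fourierF5 F ξ) =
      𝔼 x, (starRingEnd ℂ) (F x) * F x := by
    have h1 : ∀ ξ, (starRingEnd ℂ) (fourierF5 F ξ) = 𝔼 x, (starRingEnd ℂ) (F x) * ec (ξ ⬝ᵥ x) := by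
      intro ξ
      rw [fourierF5, conj_expect]
      simp [conj_ec]
    simp only [h1, Finset.mul_expect]
    rw [← Finset.expect_sum_comm]
    refine Finset.expect_congr rfl fun x _ => ?_
    have h2 : (starRingEnd ℂ) (F x) * F x =
        (starRingEnd ℂ) (F x) * ∑ ξ, fourierF5 F ξ * ec (ξ ⬝ᵥ x) := by rw [← fourierF5_inversion]
    rw [h2, Finset.mul_sum]
    refine Finset.sum_congr rfl fun ξ _ => ?_
    ring
  have h' : ((∑ ξ, ‖fourierF5 F ξ‖ ^ 2 : ℝ) : ℂ) = ((𝔼 x, ‖F x‖ ^ 2 : ℝ) : ℂ) := by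
    rw [ofReal_expect]
    push_cast
    simp only [← Complex.mul_conj']
    rw [h]
    simp only [mul_comm]
  exact_mod_cast h'

theorem norm_expect_le_one {ι : Type*} [Fintype ι] [Nonempty ι] {F : ι → ℂ} (hF : ∀ x, ‖F x‖ ≤ 1) :
    ‖𝔼 x, F x‖ ≤ 1 :=
  (RCLike.norm_expect_le (K := ℂ)).trans (Finset.expect_le Finset.univ_nonempty fun x _ => hF x)

theorem norm_fourierF5_le_one {F : F5n n → ℂ} (hF : ∀ x, ‖F x‖ ≤ 1) (ξ : F5n n) :
    ‖fourierF5 F ξ‖ ≤ 1 :=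
  norm_expect_le_one fun x => by rw [norm_mul, norm_ec, mul_one]; exact hF x

theorem sum_norm_fourierF5_sq_le_one {F : F5n n → ℂ} (hF : ∀ x, ‖F x‖ ≤ 1) :
    ∑ ξ, ‖fourierF5 F ξ‖ ^ 2 ≤ 1 := by
  rw [sum_norm_fourierF5_sq]
  exact Finset.expect_le Finset.univ_nonempty fun x _ => pow_le_one₀ (norm_nonneg _) (hF x)

/-- After Fourier inversion of `d`, the identity x + h + k = (x + h) + (x + k) - x splits the
character, and the averages over the other three vertices decouple. -/
theorem expect_box_eq_sum_fourierF5 (a b c d : F5n n → ℂ) :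
    𝔼 x, 𝔼 h, 𝔼 k, a x * b (x + h) * c (x + k) * d (x + h + k) =
      ∑ ξ, fourierF5 d ξ * fourierF5 a ξ * (fourierF5 b (-ξ) * fourierF5 c (-ξ)) := by
  have e1 : ∀ ξ, fourierF5 d ξ * fourierF5 a ξ * (fourierF5 b (-ξ) * fourierF5 c (-ξ)) =
      𝔼 x, 𝔼 y, 𝔼 z, fourierF5 d ξ * (a x * ec (-(ξ ⬝ᵥ x))) *
        (b y * ec (-(-ξ ⬝ᵥ y)) * (c z * ec (-(-ξ ⬝ᵥ z)))) := by
    intro ξ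
    simp only [← Finset.mul_expect, ← Finset.expect_mul]
    rfl
  simp only [e1]
  rw [← Finset.expect_sum_comm]
  refine Finset.expect_congr rfl fun x _ => ?_
  rw [← Finset.expect_sum_comm]
  refine Fintype.expect_equiv (Equiv.addLeft x) _ _ fun h => ?_
  rw [← Finset.expect_sum_comm]
  refine Fintype.expect_equiv (Equiv.addLeft x) _ _ fun k => ?_
  simp only [Equiv.coe_addLeft]
  rw [fourierF5_inversion d (x + h + k), Finset.mul_sum]
  refine Finset.sum_congr rfl fun ξ _ => ?_
  have : ec (ξ ⬝ᵥ (x + h + k)) =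
      ec (-(ξ ⬝ᵥ x)) * (ec (-(-ξ ⬝ᵥ (x + h))) * ec (-(-ξ ⬝ᵥ (x + k)))) := by
    rw [← AddChar.map_add_eq_mul, ← AddChar.map_add_eq_mul]
    congr 1
    simp only [dotProduct_add, neg_dotProduct]
    ring
  rw [this]
  ring

/-- The inverse theorem for the box norm: if the box average of `1`-bounded functions is large
then the first function has a large Fourier coefficient. -/
theorem exists_norm_fourierF5_ge (a b c d : F5n n → ℂ) (hb : ∀ x, ‖b x‖ ≤ 1)
    (hc : ∀ x, ‖c x‖ ≤ 1) (hd : ∀ x, ‖d x‖ ≤ 1) :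
    ∃ ξ, ‖𝔼 x, 𝔼 h, 𝔼 k, a x * b (x + h) * c (x + k) * d (x + h + k)‖ ≤ ‖fourierF5 a ξ‖ := by
  obtain ⟨ξ₀, -, hξ₀⟩ := Finset.univ.exists_max_image (fun ξ => ‖fourierF5 a ξ‖)
    Finset.univ_nonempty
  refine ⟨ξ₀, ?_⟩
  rw [expect_box_eq_sum_fourierF5]
  set s := ‖fourierF5 a ξ₀‖
  have hneg : ∑ ξ, ‖fourierF5 b (-ξ)‖ ^ 2 = ∑ ξ, ‖fourierF5 b ξ‖ ^ 2 :=
    Fintype.sum_equiv (Equiv.neg _) _ _ fun _ => rfl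
  calc _ ≤ ∑ ξ, ‖fourierF5 d ξ * fourierF5 a ξ * (fourierF5 b (-ξ) * fourierF5 c (-ξ))‖ :=
        norm_sum_le _ _
    -- The coefficient of `a` is bounded by its maximum and that of `c` by 1; AM–GM leaves squares
    -- of those of `d` and `b` for Parseval.
    _ ≤ ∑ ξ, s * ((‖fourierF5 d ξ‖ ^ 2 + ‖fourierF5 b (-ξ)‖ ^ 2) / 2) := by
        refine Finset.sum_le_sum fun ξ _ => ?_
        simp only [norm_mul]
        have h1 : ‖fourierF5 d ξ‖ * ‖fourierF5 b (-ξ)‖ ≤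
            (‖fourierF5 d ξ‖ ^ 2 + ‖fourierF5 b (-ξ)‖ ^ 2) / 2 := by
          linarith [two_mul_le_add_sq ‖fourierF5 d ξ‖ ‖fourierF5 b (-ξ)‖]
        calc _ = ‖fourierF5 a ξ‖ * (‖fourierF5 d ξ‖ * ‖fourierF5 b (-ξ)‖) *
              ‖fourierF5 c (-ξ)‖ := by ring
          _ ≤ ‖fourierF5 a ξ‖ * (‖fourierF5 d ξ‖ * ‖fourierF5 b (-ξ)‖) * 1 := by
              gcongr
              exact norm_fourierF5_le_one hc _
          _ ≤ s * ((‖fourierF5 d ξ‖ ^ 2 + ‖fourierF5 b (-ξ)‖ ^ 2) / 2) := by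
              rw [mul_one]
              gcongr
              exact hξ₀ ξ (Finset.mem_univ _)
    _ = s * ((∑ ξ, ‖fourierF5 d ξ‖ ^ 2 + ∑ ξ, ‖fourierF5 b ξ‖ ^ 2) / 2) := by
        rw [← Finset.mul_sum, ← Finset.sum_div, Finset.sum_add_distrib, hneg]
    _ ≤ s * ((1 + 1) / 2) := by
        gcongr
        · exact sum_norm_fourierF5_sq_le_one hd
        · exact sum_norm_fourierF5_sq_le_one hb
    _ = s := by ring

end Fourier

/-! ### Cauchy–Schwarz estimates for correlations and bilinear phases -/

section CauchySchwarz

variable {n : ℕ}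

theorem sq_expect_le {ι : Type*} [Fintype ι] [Nonempty ι] (u : ι → ℝ) :
    (𝔼 x, u x) ^ 2 ≤ 𝔼 x, u x ^ 2 := by
  have := Finset.expect_mul_sq_le_sq_mul_sq Finset.univ u (fun _ => (1 : ℝ))
  simpa using this

theorem norm_expect_sq_le {ι : Type*} [Fintype ι] [Nonempty ι] (S : ι → ℂ) :
    ‖𝔼 x, S x‖ ^ 2 ≤ 𝔼 x, ‖S x‖ ^ 2 :=
  (pow_le_pow_left₀ (norm_nonneg _) (RCLike.norm_expect_le (K := ℂ)) 2).trans (sq_expect_le _)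

theorem norm_expect_mul_sq_le {ι : Type*} [Fintype ι] [Nonempty ι] {F : ι → ℂ}
    (hF : ∀ x, ‖F x‖ ≤ 1) (S : ι → ℂ) : ‖𝔼 x, F x * S x‖ ^ 2 ≤ 𝔼 x, ‖S x‖ ^ 2 := by
  refine (norm_expect_sq_le _).trans (Finset.expect_le_expect fun x _ => ?_)
  rw [norm_mul, mul_pow]
  exact mul_le_of_le_one_left (by positivity) (pow_le_one₀ (norm_nonneg _) (hF x))

/-- A correlation of `P` with bounded functions is controlled by the autocorrelation of `P`. -/
theorem norm_expect_correlation_pow_four_le {F G : F5n n → ℂ} (hF : ∀ x, ‖F x‖ ≤ 1)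
    (hG : ∀ x, ‖G x‖ ≤ 1) (P : F5n n → ℂ) :
    ‖𝔼 x, F x * 𝔼 h, P h * G (x + h)‖ ^ 4 ≤
      𝔼 t, ‖𝔼 h, P h * (starRingEnd ℂ) (P (h - t))‖ ^ 2 := by
  have h1 := norm_expect_mul_sq_le hF fun x => 𝔼 h, P h * G (x + h)
  set E := 𝔼 x, ‖𝔼 h, P h * G (x + h)‖ ^ 2 with hE
  -- Opening the square and substituting y = x + h makes `G` enter only through its autocorrelation,
  -- which the second Cauchy–Schwarz discards.
  have h2 : (E : ℂ) = 𝔼 t, (𝔼 y, G y * (starRingEnd ℂ) (G (y - t))) *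
      𝔼 h, P h * (starRingEnd ℂ) (P (h - t)) := by
    have e1 : ∀ x, ((‖𝔼 h, P h * G (x + h)‖ ^ 2 : ℝ) : ℂ) =
        𝔼 h, 𝔼 t, P h * G (x + h) *
          ((starRingEnd ℂ) (P (h - t)) * (starRingEnd ℂ) (G (x + h - t))) := by
      intro x
      push_cast
      rw [← Complex.mul_conj', conj_expect, Finset.expect_mul]
      refine Finset.expect_congr rfl fun h _ => ?_
      rw [Finset.mul_expect]
      refine (Fintype.expect_equiv (Equiv.subLeft h) _ _ fun t => ?_).symm
      simp [add_sub_assoc]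
    rw [hE, ofReal_expect]
    simp only [e1]
    rw [Finset.expect_comm]
    simp only [Finset.mul_expect, Finset.expect_mul]
    rw [Finset.expect_comm (s := Finset.univ) (t := Finset.univ)
      (f := fun t h => 𝔼 y, G y * (starRingEnd ℂ) (G (y - t)) *
        (P h * (starRingEnd ℂ) (P (h - t))))]
    refine Finset.expect_congr rfl fun h _ => ?_
    rw [Finset.expect_comm]
    refine Finset.expect_congr rfl fun t _ => ?_
    refine Fintype.expect_equiv (Equiv.addRight h) _ _ fun x => ?_
    simp only [Equiv.coe_addRight]
    ring
  have h3 : E ^ 2 ≤ 𝔼 t, ‖𝔼 h, P h * (starRingEnd ℂ) (P (h - t))‖ ^ 2 := by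
    have h4 : E ^ 2 = ‖(E : ℂ)‖ ^ 2 := by rw [Complex.norm_real, Real.norm_eq_abs, sq_abs]
    rw [h4, h2]
    refine norm_expect_mul_sq_le (fun t => norm_expect_le_one fun y => ?_) _
    rw [norm_mul, RCLike.norm_conj]
    exact mul_le_one₀ (hG _) (norm_nonneg _) (hG _)
  calc ‖𝔼 x, F x * 𝔼 h, P h * G (x + h)‖ ^ 4
      = (‖𝔼 x, F x * 𝔼 h, P h * G (x + h)‖ ^ 2) ^ 2 := by ring
    _ ≤ E ^ 2 := pow_le_pow_left₀ (by positivity) h1 2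
    _ ≤ _ := h3

/-- A bilinear phase with a matrix of large range does not correlate with a product. -/
theorem norm_expect_bilinear_sq_mul_card_range_le {F G : F5n n → ℂ} (hF : ∀ x, ‖F x‖ ≤ 1)
    (hG : ∀ x, ‖G x‖ ≤ 1) (S : Matrix (Fin n) (Fin n) (ZMod 5)) :
    ‖𝔼 x, 𝔼 y, F x * G y * ec (x ⬝ᵥ S.mulVec y)‖ ^ 2 *
      (Finset.univ.image S.mulVec).card ≤ 1 := by
  classical
  set R : F5n n → ℂ := fun x => 𝔼 y, G y * ec (x ⬝ᵥ S.mulVec y) with hR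
  -- The density of the fibre of S over ξ. It dominates the Fourier coefficients of R and is
  -- constant, equal to 1/|range S|, on the range, whence ∑ p² = p(0).
  set p : F5n n → ℝ := fun ξ => 𝔼 y, if S.mulVec y = ξ then (1 : ℝ) else 0 with hp
  have h1 : ‖𝔼 x, 𝔼 y, F x * G y * ec (x ⬝ᵥ S.mulVec y)‖ ^ 2 ≤ 𝔼 x, ‖R x‖ ^ 2 := by
    have : ∀ x, 𝔼 y, F x * G y * ec (x ⬝ᵥ S.mulVec y) = F x * R x := by
      intro x
      simp only [hR, Finset.mul_expect, mul_assoc]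
    simp only [this]
    exact norm_expect_mul_sq_le hF R
  have h2 : ∀ ξ, fourierF5 R ξ = 𝔼 y, if S.mulVec y = ξ then G y else 0 := by
    intro ξ
    simp only [fourierF5, hR, Finset.expect_mul]
    rw [Finset.expect_comm]
    refine Finset.expect_congr rfl fun y _ => ?_
    have : ∀ x, G y * ec (x ⬝ᵥ S.mulVec y) * ec (-(ξ ⬝ᵥ x)) = G y * ec (x ⬝ᵥ (S.mulVec y - ξ)) := by
      intro x
      rw [mul_assoc, ← AddChar.map_add_eq_mul, dotProduct_sub, sub_eq_add_neg, dotProduct_comm ξ x]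
    simp only [this, ← Finset.mul_expect, expect_ec_dotProduct, sub_eq_zero]
    split_ifs <;> simp
  have h3 : ∀ ξ, ‖fourierF5 R ξ‖ ≤ p ξ := by
    intro ξ
    rw [h2]
    refine (RCLike.norm_expect_le (K := ℂ)).trans (Finset.expect_le_expect fun y _ => ?_)
    split_ifs
    · exact hG y
    · simp
  have hp0 : ∀ ξ, 0 ≤ p ξ := fun ξ => (norm_nonneg _).trans (h3 ξ)
  have hpsum : ∑ ξ, p ξ = 1 := by
    simp only [hp]
    rw [← Finset.expect_sum_comm]
    simp
  have hpr : ∀ ξ ∈ Finset.univ.image S.mulVec, p ξ = p 0 := by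
    intro ξ hξ
    obtain ⟨z, -, rfl⟩ := Finset.mem_image.1 hξ
    refine Fintype.expect_equiv (Equiv.subRight z) _ _ fun y => ?_
    simp [Matrix.mulVec_sub, sub_eq_zero]
  have hpn : ∀ ξ, ξ ∉ Finset.univ.image S.mulVec → p ξ = 0 := by
    intro ξ hξ
    refine Finset.expect_eq_zero fun y _ => if_neg fun h => hξ ?_
    exact Finset.mem_image.2 ⟨y, Finset.mem_univ _, h⟩
  have hcard : p 0 * (Finset.univ.image S.mulVec).card = 1 := by
    rw [← hpsum, ← Finset.sum_subset (Finset.subset_univ (Finset.univ.image S.mulVec))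
      fun ξ _ h => hpn ξ h, Finset.sum_congr rfl hpr, Finset.sum_const, nsmul_eq_mul, mul_comm]
  have hple : ∀ ξ, p ξ ≤ p 0 := by
    intro ξ
    by_cases h : ξ ∈ Finset.univ.image S.mulVec
    · exact (hpr ξ h).le
    · rw [hpn ξ h]; exact hp0 0
  have h4 : 𝔼 x, ‖R x‖ ^ 2 ≤ p 0 := by
    rw [← sum_norm_fourierF5_sq]
    calc _ ≤ ∑ ξ, p 0 * p ξ := by
          refine Finset.sum_le_sum fun ξ _ => ?_
          rw [sq]
          exact mul_le_mul ((h3 ξ).trans (hple ξ)) (h3 ξ) (norm_nonneg _) (hp0 0)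
      _ = p 0 := by rw [← Finset.mul_sum, hpsum, mul_one]
  calc _ ≤ p 0 * (Finset.univ.image S.mulVec).card := by
        gcongr
        exact h1.trans h4
    _ = 1 := hcard

end CauchySchwarz

/-- The multiplicative derivative `x ↦ f(x) f(x + h)`, as a complex-valued function. -/
def mulDeriv {n : ℕ} (f : F5n n → ℝ) (h x : F5n n) : ℂ :=
  (f x : ℂ) * (f (x + h) : ℂ)

/-! ### The inverse theorem for the U³ norm -/

section InverseTheorem

variable {n : ℕ}

theorem norm_ofReal_le_one {f : F5n n → ℝ} (hf : ∀ x, |f x| ≤ 1) (x : F5n n) : ‖(f x : ℂ)‖ ≤ 1 := by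
  rw [Complex.norm_real]
  exact hf x

theorem norm_mulDeriv_le_one {f : F5n n → ℝ} (hf : ∀ x, |f x| ≤ 1) (h x : F5n n) :
    ‖mulDeriv f h x‖ ≤ 1 := by
  rw [mulDeriv, norm_mul]
  exact mul_le_one₀ (norm_ofReal_le_one hf _) (norm_nonneg _) (norm_ofReal_le_one hf _)

/-- The eighth power of the U³ norm is the average over h of the box average of the derivative in
direction h, to which the box inverse theorem applies. -/
theorem exists_le_expect_norm_fourierF5_mulDeriv {f : F5n n → ℝ} (hf : ∀ x, |f x| ≤ 1) :
    ∃ φ : F5n n → F5n n, gowersU3Pow f ≤ 𝔼 h, ‖fourierF5 (mulDeriv f h) (φ h)‖ := by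
  have hD := fun h => norm_mulDeriv_le_one hf h
  choose φ hφ using fun h => exists_norm_fourierF5_ge (mulDeriv f h) (mulDeriv f h) (mulDeriv f h)
    (mulDeriv f h) (hD h) (hD h) (hD h)
  refine ⟨φ, ?_⟩
  have h1 : (gowersU3Pow f : ℂ) = 𝔼 h, 𝔼 x, 𝔼 k, 𝔼 l,
      mulDeriv f h x * mulDeriv f h (x + k) * mulDeriv f h (x + l) * mulDeriv f h (x + k + l) := by
    rw [gowersU3Pow, Finset.expect_comm]
    simp only [ofReal_expect]
    refine Finset.expect_congr rfl fun h _ => Finset.expect_congr rfl fun x _ =>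
      Finset.expect_congr rfl fun k _ => Finset.expect_congr rfl fun l _ => ?_
    simp only [mulDeriv]
    push_cast
    rw [add_right_comm x k h, add_right_comm x l h, add_right_comm (x + k) l h,
      add_right_comm x k h]
    ring
  calc gowersU3Pow f = ‖(gowersU3Pow f : ℂ)‖ := by
        rw [Complex.norm_real, Real.norm_eq_abs, abs_of_nonneg (gowersU3Pow_nonneg f)]
    _ ≤ _ := by
        rw [h1]
        exact (RCLike.norm_expect_le (K := ℂ)).trans (Finset.expect_le_expect fun h _ => hφ h)

/-- Apart from the character, the right-hand side is a parallelogram average symmetric in h and k.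
Both the energy bound and the symmetry argument exploit this. -/
theorem norm_fourierF5_mulDeriv_sq (f : F5n n → ℝ) (h ξ : F5n n) :
    ((‖fourierF5 (mulDeriv f h) ξ‖ ^ 2 : ℝ) : ℂ) =
      𝔼 x, 𝔼 k, (f x : ℂ) * f (x + h) * (f (x + k) * f (x + k + h)) * ec (ξ ⬝ᵥ k) := by
  push_cast
  rw [← Complex.mul_conj', fourierF5, conj_expect, Finset.expect_mul]
  refine Finset.expect_congr rfl fun x _ => ?_
  rw [Finset.mul_expect]
  refine (Fintype.expect_equiv (Equiv.addLeft x) _ _ fun k => ?_).symm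
  have : ec (ξ ⬝ᵥ k) = ec (-(ξ ⬝ᵥ x)) * ec (ξ ⬝ᵥ (x + k)) := by
    rw [← AddChar.map_add_eq_mul, dotProduct_add, neg_add_cancel_left]
  simp only [Equiv.coe_addLeft, mulDeriv, map_mul, Complex.conj_ofReal, conj_ec, neg_neg, this]
  ring

open Classical in
/-- If many derivatives of `f` have a large Fourier coefficient at `φ(h)`, then the graph of `φ`
has large additive energy. -/
theorem pow_four_expect_le_energy {f : F5n n → ℝ} (hf : ∀ x, |f x| ≤ 1) (φ : F5n n → F5n n)
    (A : Finset (F5n n)) :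
    (𝔼 h, if h ∈ A then ‖fourierF5 (mulDeriv f h) (φ h)‖ ^ 2 else 0) ^ 4 *
        (Fintype.card (F5n n) : ℝ) ^ 3 ≤
      ∑ d : F5n n × F5n n,
        diffConv (fun x : F5n n × F5n n => if x.1 ∈ A ∧ x.2 = φ x.1 then (1 : ℝ) else 0) d ^ 2 := by
  set N : ℝ := (Fintype.card (F5n n) : ℝ) with hN
  have hN0 : 0 < N := by rw [hN]; exact_mod_cast Fintype.card_pos
  set E : ℝ := 𝔼 h, if h ∈ A then ‖fourierF5 (mulDeriv f h) (φ h)‖ ^ 2 else 0 with hE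
  have hE0 : 0 ≤ E := Finset.expect_nonneg fun h _ => by split_ifs <;> positivity
  let P : F5n n → F5n n → ℂ := fun k h => if h ∈ A then ec (φ h ⬝ᵥ k) else 0
  -- The roles of h and k are exchanged: the parallelogram is regrouped into derivatives in
  -- direction k, leaving φ only in the phase P.
  have h1 : (E : ℂ) = 𝔼 k, 𝔼 x, mulDeriv f k x * 𝔼 h, P k h * mulDeriv f k (x + h) := by
    rw [hE, ofReal_expect]
    simp only [Finset.mul_expect]
    have h2 : ∀ h, (((if h ∈ A then ‖fourierF5 (mulDeriv f h) (φ h)‖ ^ 2 else 0 : ℝ)) : ℂ) =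
        𝔼 k, 𝔼 x, mulDeriv f k x * (P k h * mulDeriv f k (x + h)) := by
      intro h
      by_cases hA : h ∈ A
      · simp only [hA, if_true, P]
        rw [norm_fourierF5_mulDeriv_sq, Finset.expect_comm]
        refine Finset.expect_congr rfl fun k _ => Finset.expect_congr rfl fun x _ => ?_
        simp only [mulDeriv]
        rw [add_right_comm x k h]
        ring
      · simp [hA, P]
    simp only [h2]
    rw [Finset.expect_comm]
    exact Finset.expect_congr rfl fun k _ => Finset.expect_comm _ _ _
  have h2 : E ^ 4 ≤ 𝔼 k, 𝔼 t, ‖𝔼 h, P k h * (starRingEnd ℂ) (P k (h - t))‖ ^ 2 := by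
    set X : F5n n → ℂ := fun k => 𝔼 x, mulDeriv f k x * 𝔼 h, P k h * mulDeriv f k (x + h) with hX
    have h3 : E ^ 4 = (‖𝔼 k, X k‖ ^ 2) ^ 2 := by
      rw [← h1, Complex.norm_real, Real.norm_eq_abs, sq_abs]; ring
    rw [h3]
    calc (‖𝔼 k, X k‖ ^ 2) ^ 2 ≤ (𝔼 k, ‖X k‖ ^ 2) ^ 2 :=
          pow_le_pow_left₀ (by positivity) (norm_expect_sq_le _) 2
      _ ≤ 𝔼 k, (‖X k‖ ^ 2) ^ 2 := sq_expect_le _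
      _ ≤ _ := by
          refine Finset.expect_le_expect fun k _ => ?_
          rw [← pow_mul]
          exact norm_expect_correlation_pow_four_le (norm_mulDeriv_le_one hf k)
            (norm_mulDeriv_le_one hf k) (P k)
  -- By orthogonality in k, the coefficient at s counts, up to the factor N, pairs of graph points
  -- with difference (t, s). Parseval then produces the energy.
  have h3 : ∀ t s, N * ‖fourierF5 (fun k => 𝔼 h, P k h * (starRingEnd ℂ) (P k (h - t))) s‖ =
      diffConv (fun x : F5n n × F5n n => if x.1 ∈ A ∧ x.2 = φ x.1 then (1 : ℝ) else 0) (t, s) := by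
    intro t s
    have h4 : fourierF5 (fun k => 𝔼 h, P k h * (starRingEnd ℂ) (P k (h - t))) s =
        ((𝔼 h, if h ∈ A ∧ h - t ∈ A ∧ φ h - s = φ (h - t) then (1 : ℝ) else 0 : ℝ) : ℂ) := by
      simp only [fourierF5, Finset.expect_mul]
      rw [Finset.expect_comm, ofReal_expect]
      refine Finset.expect_congr rfl fun h _ => ?_
      by_cases hA : h ∈ A
      · by_cases hA' : h - t ∈ A
        · simp only [P, hA, hA', if_true, true_and, conj_ec]
          have h5 : ∀ k, ec (φ h ⬝ᵥ k) * ec (-(φ (h - t) ⬝ᵥ k)) * ec (-(s ⬝ᵥ k)) =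
              ec (k ⬝ᵥ (φ h - s - φ (h - t))) := by
            intro k
            rw [← AddChar.map_add_eq_mul, ← AddChar.map_add_eq_mul, dotProduct_comm k,
              sub_dotProduct, sub_dotProduct]
            congr 1
            ring
          simp only [h5, expect_ec_dotProduct, sub_eq_zero]
          split_ifs <;> simp
        · simp [P, hA']
      · simp [P, hA]
    rw [h4, Complex.norm_real, Real.norm_of_nonneg
      (Finset.expect_nonneg fun h _ => by split_ifs <;> norm_num), hN, Fintype.card_mul_expect,
      diffConv, Fintype.sum_prod_type]
    refine Finset.sum_congr rfl fun h _ => ?_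
    rw [Finset.sum_eq_single (φ h)]
    · by_cases a1 : h ∈ A <;> by_cases a2 : h - t ∈ A <;> simp [a1, a2]
    · intro v _ hv
      simp [hv]
    · simp
  have h4 : 𝔼 k, 𝔼 t, ‖𝔼 h, P k h * (starRingEnd ℂ) (P k (h - t))‖ ^ 2 =
      𝔼 t, ∑ s, ‖fourierF5 (fun k => 𝔼 h, P k h * (starRingEnd ℂ) (P k (h - t))) s‖ ^ 2 := by
    simp only [sum_norm_fourierF5_sq]
    exact Finset.expect_comm _ _ _
  calc E ^ 4 * N ^ 3 ≤ (𝔼 t, ∑ s,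
        ‖fourierF5 (fun k => 𝔼 h, P k h * (starRingEnd ℂ) (P k (h - t))) s‖ ^ 2) * N ^ 3 := by
        rw [← h4]
        gcongr
    _ = N ^ 2 * (N * 𝔼 t, ∑ s,
        ‖fourierF5 (fun k => 𝔼 h, P k h * (starRingEnd ℂ) (P k (h - t))) s‖ ^ 2) := by ring
    _ = _ := by
        rw [hN, Fintype.card_mul_expect, ← hN, Fintype.sum_prod_type, Finset.mul_sum]
        refine Finset.sum_congr rfl fun t _ => ?_
        rw [Finset.mul_sum]
        refine Finset.sum_congr rfl fun s _ => ?_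
        rw [← h3, mul_pow]

/-- The symmetry argument: if `h ↦ Th + b` captures large Fourier coefficients of many
derivatives, then `T - Tᵀ` takes few values. -/
theorem sq_expect_mul_card_range_le {f : F5n n → ℝ} (hf : ∀ x, |f x| ≤ 1)
    (T : Matrix (Fin n) (Fin n) (ZMod 5)) (b : F5n n) :
    (𝔼 h, ‖fourierF5 (mulDeriv f h) (T.mulVec h + b)‖ ^ 2) ^ 2 *
      (Finset.univ.image (T.transpose - T).mulVec).card ≤ 1 := by
  set E := 𝔼 h, ‖fourierF5 (mulDeriv f h) (T.mulVec h + b)‖ ^ 2 with hE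
  set S := T.transpose - T with hS
  -- Substitute y = x + h and u = x + y + k, so that the vertices are x, y, u - y, u - x. For fixed
  -- u everything is a function of x times one of y, except the phase xᵀ(Tᵀ - T)y.
  let F : F5n n → F5n n → ℂ := fun u x =>
    (f x : ℂ) * f (u - x) * ec (-(T.mulVec x ⬝ᵥ u) + T.mulVec x ⬝ᵥ x - b ⬝ᵥ x)
  let G : F5n n → F5n n → ℂ := fun u y =>
    (f y : ℂ) * f (u - y) * ec (T.mulVec y ⬝ᵥ u - T.mulVec y ⬝ᵥ y + b ⬝ᵥ u - b ⬝ᵥ y)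
  have hb : ∀ u x t, ‖(f x : ℂ) * f (u - x) * ec t‖ ≤ 1 := by
    intro u x t
    rw [norm_mul, norm_mul, norm_ec, mul_one]
    exact mul_le_one₀ (norm_ofReal_le_one hf _) (norm_nonneg _) (norm_ofReal_le_one hf _)
  have h1 : (E : ℂ) = 𝔼 u, 𝔼 x, 𝔼 y, F u x * G u y * ec (x ⬝ᵥ S.mulVec y) := by
    rw [hE, ofReal_expect]
    simp only [norm_fourierF5_mulDeriv_sq]
    rw [Finset.expect_comm]
    have h2 : ∀ x, 𝔼 h, 𝔼 k, (f x : ℂ) * f (x + h) * (f (x + k) * f (x + k + h)) *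
        ec ((T.mulVec h + b) ⬝ᵥ k) = 𝔼 y, 𝔼 u, F u x * G u y * ec (x ⬝ᵥ S.mulVec y) := by
      intro x
      refine Fintype.expect_equiv (Equiv.addLeft x) _ _ fun h => ?_
      refine Fintype.expect_equiv (Equiv.addLeft (x + (x + h))) _ _ fun k => ?_
      simp only [Equiv.coe_addLeft, F, G]
      have e1 : x + (x + h) + k - x = x + k + h := by abel
      have e2 : x + (x + h) + k - (x + h) = x + k := by abel
      have e3 : ec ((T.mulVec h + b) ⬝ᵥ k) =
          ec (-(T.mulVec x ⬝ᵥ (x + (x + h) + k)) + T.mulVec x ⬝ᵥ x - b ⬝ᵥ x) *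
          ec (T.mulVec (x + h) ⬝ᵥ (x + (x + h) + k) - T.mulVec (x + h) ⬝ᵥ (x + h) +
            b ⬝ᵥ (x + (x + h) + k) - b ⬝ᵥ (x + h)) * ec (x ⬝ᵥ S.mulVec (x + h)) := by
        rw [← AddChar.map_add_eq_mul, ← AddChar.map_add_eq_mul]
        congr 1
        have e4 : ∀ z, x ⬝ᵥ T.transpose.mulVec z = T.mulVec x ⬝ᵥ z := by
          intro z
          rw [Matrix.dotProduct_mulVec, Matrix.vecMul_transpose]
        simp only [hS, Matrix.sub_mulVec, dotProduct_sub, e4, Matrix.mulVec_add, dotProduct_add,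
          add_dotProduct]
        rw [dotProduct_comm x (T.mulVec x), dotProduct_comm x (T.mulVec h)]
        ring
      rw [e1, e2, e3]
      ring
    simp only [h2]
    rw [Finset.expect_comm (s := Finset.univ) (t := Finset.univ) (f := fun u x =>
      𝔼 y, F u x * G u y * ec (x ⬝ᵥ S.mulVec y))]
    exact Finset.expect_congr rfl fun x _ => Finset.expect_comm _ _ _
  set X : F5n n → ℂ := fun u => 𝔼 x, 𝔼 y, F u x * G u y * ec (x ⬝ᵥ S.mulVec y) with hX
  have h2 : E ^ 2 = ‖𝔼 u, X u‖ ^ 2 := by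
    rw [← h1, Complex.norm_real, Real.norm_eq_abs, sq_abs]
  rw [h2]
  calc _ ≤ (𝔼 u, ‖X u‖ ^ 2) * (Finset.univ.image S.mulVec).card := by
        gcongr
        exact norm_expect_sq_le _
    _ = 𝔼 u, ‖X u‖ ^ 2 * (Finset.univ.image S.mulVec).card := Finset.expect_mul _ _ _
    _ ≤ 1 := Finset.expect_le Finset.univ_nonempty fun u _ =>
        norm_expect_bilinear_sq_mul_card_range_le (hb u · _) (hb u · _) S

/-- Integration of a symmetric affine derivative to a quadratic phase. -/
theorem exists_quadratic_of_symm {f : F5n n → ℝ} (hf : ∀ x, |f x| ≤ 1)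
    (M : Matrix (Fin n) (Fin n) (ZMod 5)) (hM : M.IsSymm) (b : F5n n) :
    ∃ r : F5n n, 𝔼 h, ‖fourierF5 (mulDeriv f h) (M.mulVec h + b)‖ ^ 2 ≤
      ‖𝔼 x, (f x : ℂ) * ec (x ⬝ᵥ ((3 : ZMod 5) • M).mulVec x + r ⬝ᵥ x)‖ := by
  -- Here 3 = 1/2 in 𝔽₅, so the mixed second difference of q in directions h, k is (Mh)ᵀk.
  let q : F5n n → ZMod 5 := fun x => x ⬝ᵥ ((3 : ZMod 5) • M).mulVec x
  have hb : ∀ x t, ‖(f x : ℂ) * ec t‖ ≤ 1 := by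
    intro x t
    rw [norm_mul, norm_ec, mul_one]
    exact norm_ofReal_le_one hf x
  obtain ⟨ξ, hξ⟩ := exists_norm_fourierF5_ge (fun x => (f x : ℂ) * ec (q x - b ⬝ᵥ x))
    (fun x => (f x : ℂ) * ec (-q x)) (fun x => (f x : ℂ) * ec (-q x + b ⬝ᵥ x))
    (fun x => (f x : ℂ) * ec (q x)) (hb · _) (hb · _) (hb · _)
  refine ⟨-b - ξ, ?_⟩
  have h1 : fourierF5 (fun x => (f x : ℂ) * ec (q x - b ⬝ᵥ x)) ξ =
      𝔼 x, (f x : ℂ) * ec (x ⬝ᵥ ((3 : ZMod 5) • M).mulVec x + (-b - ξ) ⬝ᵥ x) := by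
    refine Finset.expect_congr rfl fun x _ => ?_
    rw [mul_assoc, ← AddChar.map_add_eq_mul]
    congr 2
    simp only [q, sub_dotProduct, neg_dotProduct]
    ring
  rw [← h1]
  set E := 𝔼 h, ‖fourierF5 (mulDeriv f h) (M.mulVec h + b)‖ ^ 2 with hE
  have hE0 : 0 ≤ E := Finset.expect_nonneg fun h _ => by positivity
  have h2 : (E : ℂ) = 𝔼 x, 𝔼 h, 𝔼 k, (f x : ℂ) * ec (q x - b ⬝ᵥ x) *
      ((f (x + h) : ℂ) * ec (-q (x + h))) * ((f (x + k) : ℂ) * ec (-q (x + k) + b ⬝ᵥ (x + k))) *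
      ((f (x + h + k) : ℂ) * ec (q (x + h + k))) := by
    rw [hE, ofReal_expect]
    simp only [norm_fourierF5_mulDeriv_sq]
    rw [Finset.expect_comm]
    refine Finset.expect_congr rfl fun x _ => Finset.expect_congr rfl fun h _ =>
      Finset.expect_congr rfl fun k _ => ?_
    have e1 : ec ((M.mulVec h + b) ⬝ᵥ k) = ec (q x - b ⬝ᵥ x) * ec (-q (x + h)) *
        ec (-q (x + k) + b ⬝ᵥ (x + k)) * ec (q (x + h + k)) := by
      rw [← AddChar.map_add_eq_mul, ← AddChar.map_add_eq_mul, ← AddChar.map_add_eq_mul]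
      congr 1
      have e2 : ∀ y z, y ⬝ᵥ M.mulVec z = z ⬝ᵥ M.mulVec y := by
        intro y z
        rw [Matrix.dotProduct_mulVec, ← Matrix.mulVec_transpose, hM.eq, dotProduct_comm]
      simp only [q, Matrix.smul_mulVec, dotProduct_smul, Matrix.mulVec_add, dotProduct_add,
        add_dotProduct, smul_eq_mul]
      rw [e2 h x, e2 k x, e2 k h, dotProduct_comm (M.mulVec h) k, e2 k h]
      have h6 : (6 : ZMod 5) = 1 := by decide
      linear_combination (-(h ⬝ᵥ M.mulVec k)) * h6
    rw [e1, add_right_comm x k h]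
    ring
  calc E = ‖(E : ℂ)‖ := by rw [Complex.norm_real, Real.norm_of_nonneg hE0]
    _ ≤ _ := by rw [h2]; exact hξ

/-- The **inverse theorem for the `U³` norm** over `𝔽₅ⁿ`. -/
theorem inverse_gowersU3 {η : ℝ} (hη : 0 < η) : ∃ c : ℝ, 0 < c ∧ ∀ (n : ℕ) (f : F5n n → ℝ),
    (∀ x, |f x| ≤ 1) → η ≤ gowersU3Pow f →
    ∃ (M : Matrix (Fin n) (Fin n) (ZMod 5)) (r : F5n n), M.IsSymm ∧
      c ≤ ‖𝔼 x, (f x : ℂ) * ec (x ⬝ᵥ M.mulVec x + r ⬝ᵥ x)‖ := by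
  classical
  set κ := (η / 2 * (η / 2) ^ 2) ^ 4 with hκ
  obtain ⟨c, hc0, hc⟩ := exists_affine_of_energy (κ := κ) (by positivity)
  set η₂ := c * (η / 2) * (η / 2) ^ 2 with hη₂
  have hη₂0 : 0 < η₂ := by positivity
  -- The affine map captures average at least η₂, and pigeonholing over at most η₂⁻² values of Tᵀ -
  -- T leaves η₂³.
  refine ⟨η₂ ^ 3, by positivity, ?_⟩
  intro n f hf hfη
  obtain ⟨φ, hφ⟩ := exists_le_expect_norm_fourierF5_mulDeriv hf
  set w : F5n n → ℝ := fun h => ‖fourierF5 (mulDeriv f h) (φ h)‖ with hw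
  set N : ℝ := (Fintype.card (F5n n) : ℝ) with hN
  have hN0 : 0 < N := by rw [hN]; exact_mod_cast Fintype.card_pos
  have hw1 : ∀ h, w h ≤ 1 := fun h => norm_fourierF5_le_one (norm_mulDeriv_le_one hf h) _
  let A : Finset (F5n n) := Finset.univ.filter fun h => η / 2 ≤ w h
  have hind : ∀ B : Finset (F5n n), 𝔼 h, (if h ∈ B then (1 : ℝ) else 0) = B.card / N := by
    intro B
    rw [Fintype.expect_eq_sum_div_card]
    simp [hN]
  have hAcard : η / 2 * N ≤ A.card := by
    have h1 : η ≤ 𝔼 h, ((if h ∈ A then (1 : ℝ) else 0) + η / 2) := by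
      refine hfη.trans (hφ.trans (Finset.expect_le_expect fun h _ => ?_))
      by_cases hA : h ∈ A
      · simp only [hA, if_true]
        linarith [hw1 h]
      · simp only [hA, if_false, zero_add]
        have : ¬ η / 2 ≤ w h := fun h' => hA (Finset.mem_filter.2 ⟨Finset.mem_univ _, h'⟩)
        exact (not_le.1 this).le
    rw [Finset.expect_add_distrib, hind, Fintype.expect_const] at h1
    rw [← le_div_iff₀ hN0]
    linarith
  have hAge : ∀ h ∈ A, η / 2 ≤ w h := fun h hA => (Finset.mem_filter.1 hA).2
  have hA0 : A.Nonempty := by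
    rw [← Finset.card_pos]
    have : (0 : ℝ) < A.card := lt_of_lt_of_le (by positivity) hAcard
    exact_mod_cast this
  have hAN : (A.card : ℝ) ≤ N := by rw [hN]; exact_mod_cast Finset.card_le_univ A
  have hlow : ∀ B ⊆ A, ∀ β : ℝ, β * N ≤ B.card → β * (η / 2) ^ 2 ≤
      𝔼 h, if h ∈ B then w h ^ 2 else 0 := by
    intro B hB β hβ
    calc β * (η / 2) ^ 2 ≤ (𝔼 h, if h ∈ B then (1 : ℝ) else 0) * (η / 2) ^ 2 := by
          rw [hind]
          gcongr
          rwa [le_div_iff₀ hN0]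
      _ ≤ _ := by
          rw [Finset.expect_mul]
          refine Finset.expect_le_expect fun h _ => ?_
          split_ifs with hh
          · rw [one_mul]
            exact pow_le_pow_left₀ (by positivity) (hAge h (hB hh)) 2
          · simp
  have hen : κ * (A.card : ℝ) ^ 3 ≤ ∑ d : F5n n × F5n n,
      diffConv (fun x : F5n n × F5n n => if x.1 ∈ A ∧ x.2 = φ x.1 then (1 : ℝ) else 0) d ^ 2 := by
    refine le_trans ?_ (pow_four_expect_le_energy hf φ A)
    rw [hκ]
    gcongr
    exact hlow A subset_rfl _ hAcard
  obtain ⟨T, b, hT⟩ := hc (F5n n) φ A hA0 (by convert hen)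
  obtain ⟨T', hTT⟩ : ∃ T' : Matrix (Fin n) (Fin n) (ZMod 5), ∀ h, T h = T'.mulVec h :=
    ⟨LinearMap.toMatrix' T, fun h => (LinearMap.toMatrix'_mulVec T h).symm⟩
  set E := 𝔼 h, ‖fourierF5 (mulDeriv f h) (T'.mulVec h + b)‖ ^ 2 with hE
  have hEη : η₂ ≤ E := by
    refine (hlow (A.filter fun h => φ h = T h + b) (Finset.filter_subset _ _) (c * (η / 2)) ?_).trans
      (Finset.expect_le_expect fun h _ => ?_)
    · calc c * (η / 2) * N = c * (η / 2 * N) := by ring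
        _ ≤ c * A.card := by gcongr
        _ ≤ _ := by convert hT
    · split_ifs with hh
      · have := (Finset.mem_filter.1 hh).2
        simp only [hw]
        rw [this, hTT]
      · positivity
  set S := T'.transpose - T' with hS
  set R := Finset.univ.image S.mulVec with hR
  have hRc : η₂ ^ 2 * R.card ≤ 1 := by
    refine le_trans ?_ (sq_expect_mul_card_range_le hf T' b)
    gcongr
  -- The symmetric part (T + Tᵀ)/2, so that T = M - S/2.
  set M := (3 : ZMod 5) • (T' + T'.transpose) with hM
  have hMs : M.IsSymm := by
    rw [hM, Matrix.IsSymm, Matrix.transpose_smul, Matrix.transpose_add, Matrix.transpose_transpose,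
      add_comm]
  have hTM : ∀ h, T'.mulVec h = M.mulVec h - (3 : ZMod 5) • S.mulVec h := by
    intro h
    have : T' = M - (3 : ZMod 5) • S := by
      rw [hM, hS]
      have h6 : (6 : ZMod 5) = 1 := by decide
      have : (3 : ZMod 5) • (T' + T'.transpose) - (3 : ZMod 5) • (T'.transpose - T') =
          (6 : ZMod 5) • T' := by module
      rw [this, h6, one_smul]
    conv_lhs => rw [this]
    rw [Matrix.sub_mulVec, Matrix.smul_mulVec _ S]
  -- For each h the true value Sh is one of the v in R. Freezing v makes the frequency affine with
  -- symmetric linear part.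
  have hsplit : E ≤ ∑ v ∈ R,
      𝔼 h, ‖fourierF5 (mulDeriv f h) (M.mulVec h + (b - (3 : ZMod 5) • v))‖ ^ 2 := by
    rw [← Finset.expect_sum_comm]
    refine Finset.expect_le_expect fun h _ => ?_
    have hmem : S.mulVec h ∈ R := Finset.mem_image.2 ⟨h, Finset.mem_univ _, rfl⟩
    refine le_trans (le_of_eq ?_) (Finset.single_le_sum
      (f := fun v => ‖fourierF5 (mulDeriv f h) (M.mulVec h + (b - (3 : ZMod 5) • v))‖ ^ 2)
      (fun v _ => by positivity) hmem)
    rw [hTM]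
    congr 3
    abel
  have hRn : R.Nonempty := ⟨S.mulVec 0, Finset.mem_image.2 ⟨0, Finset.mem_univ _, rfl⟩⟩
  obtain ⟨v, -, hv⟩ := Finset.exists_le_of_sum_le (s := R) (f := fun _ => η₂ ^ 3)
    (g := fun v => 𝔼 h, ‖fourierF5 (mulDeriv f h) (M.mulVec h + (b - (3 : ZMod 5) • v))‖ ^ 2) hRn (by
    refine le_trans ?_ (hEη.trans hsplit)
    rw [Finset.sum_const, nsmul_eq_mul]
    calc (R.card : ℝ) * η₂ ^ 3 = η₂ * (η₂ ^ 2 * R.card) := by ring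
      _ ≤ η₂ * 1 := by gcongr
      _ = η₂ := mul_one _)
  obtain ⟨r, hr⟩ := exists_quadratic_of_symm hf M hMs (b - (3 : ZMod 5) • v)
  refine ⟨(3 : ZMod 5) • M, r, ?_, hv.trans hr⟩
  rw [Matrix.IsSymm, Matrix.transpose_smul, hMs.eq]

end InverseTheorem

/-! ### Conditional expectation and energy -/

section CondAvg

variable {n : ℕ}

theorem condAvg_eq_of_rel (B : Setoid (F5n n)) (f : F5n n → ℝ) {x y : F5n n} (h : B x y) :
    condAvg B f x = condAvg B f y := by
  classical
  unfold condAvg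
  refine Finset.expect_congr ?_ fun _ _ => rfl
  ext z
  simp only [Finset.mem_filter, Finset.mem_univ, true_and]
  exact ⟨fun hz => B.trans (B.symm h) hz, fun hz => B.trans h hz⟩

theorem abs_condAvg_le_one (B : Setoid (F5n n)) {f : F5n n → ℝ} (hf : ∀ x, |f x| ≤ 1)
    (x : F5n n) : |condAvg B f x| ≤ 1 := by
  classical
  unfold condAvg
  refine (Finset.abs_expect_le _ _).trans (Finset.expect_le ⟨x, ?_⟩ fun y _ => hf y)
  simp

/-- The conditional expectation may be dropped against a measurable function. -/
theorem expect_condAvg_mul (B : Setoid (F5n n)) (f : F5n n → ℝ) {u : F5n n → ℂ}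
    (hu : ∀ x y, B x y → u x = u y) :
    𝔼 x, (condAvg B f x : ℂ) * u x = 𝔼 x, (f x : ℂ) * u x := by
  classical
  set a : F5n n → ℂ := fun x => ((Finset.univ.filter fun y => B x y).card : ℂ) with ha
  have ha0 : ∀ x, a x ≠ 0 := by
    intro x
    have : x ∈ Finset.univ.filter fun y => B x y := by simp
    simpa [ha] using Finset.ne_empty_of_mem this
  have haB : ∀ x y, B x y → a x = a y := by
    intro x y h
    simp only [ha]
    congr 2
    ext z
    simp only [Finset.mem_filter, Finset.mem_univ, true_and]
    exact ⟨fun hz => B.trans (B.symm h) hz, fun hz => B.trans h hz⟩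
  have h1 : ∀ x, (condAvg B f x : ℂ) * u x =
      ∑ y, if B x y then (f y : ℂ) * (u x / a x) else 0 := by
    intro x
    have : (condAvg B f x : ℂ) = (∑ y, if B x y then (f y : ℂ) else 0) / a x := by
      simp only [condAvg, Finset.expect_eq_sum_div_card, Finset.sum_filter, ha]
      push_cast
      congr 1
      refine Finset.sum_congr rfl fun y _ => ?_
      split_ifs <;> simp
    rw [this, div_mul_eq_mul_div, mul_div_assoc, Finset.sum_mul]
    refine Finset.sum_congr rfl fun y _ => ?_
    split_ifs <;> simp
  simp only [Fintype.expect_eq_sum_div_card]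
  congr 1
  simp only [h1]
  rw [Finset.sum_comm]
  refine Finset.sum_congr rfl fun y _ => ?_
  have h2 : ∀ x, (if B x y then (f y : ℂ) * (u x / a x) else 0) =
      if B y x then (f y : ℂ) * (u y / a y) else 0 := by
    intro x
    by_cases h : B x y
    · have h' : B y x := B.symm h
      rw [if_pos h, if_pos h', hu x y h, haB x y h]
    · have h' : ¬ B y x := fun h' => h (B.symm h')
      rw [if_neg h, if_neg h']
  simp only [h2]
  rw [← Finset.sum_filter, Finset.sum_const, nsmul_eq_mul]
  change a y * _ = _
  field_simp [ha0 y]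

theorem expect_condAvg_mul_real (B : Setoid (F5n n)) (f : F5n n → ℝ) {u : F5n n → ℝ}
    (hu : ∀ x y, B x y → u x = u y) :
    𝔼 x, condAvg B f x * u x = 𝔼 x, f x * u x := by
  have := expect_condAvg_mul B f (u := fun x => (u x : ℂ)) fun x y h => by rw [hu x y h]
  have h1 : ((𝔼 x, condAvg B f x * u x : ℝ) : ℂ) = ((𝔼 x, f x * u x : ℝ) : ℂ) := by
    rw [ofReal_expect, ofReal_expect]
    simpa using this
  exact_mod_cast h1

/-- The energy of `f` with respect to a factor. -/
def factorEnergy (B : Setoid (F5n n)) (f : F5n n → ℝ) : ℝ := 𝔼 x, condAvg B f x ^ 2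

theorem factorEnergy_nonneg (B : Setoid (F5n n)) (f : F5n n → ℝ) : 0 ≤ factorEnergy B f :=
  Finset.expect_nonneg fun _ _ => sq_nonneg _

theorem factorEnergy_le_one (B : Setoid (F5n n)) {f : F5n n → ℝ} (hf : ∀ x, |f x| ≤ 1) :
    factorEnergy B f ≤ 1 :=
  Finset.expect_le Finset.univ_nonempty fun x _ => (sq_le_one_iff_abs_le_one _).2
    (abs_condAvg_le_one B hf x)

/-- Pythagoras: the coarser projection is measurable for the finer factor, so the cross term equals
the coarser energy. -/
theorem expect_condAvg_sub_sq {B B' : Setoid (F5n n)} (hB : B' ≤ B) (f : F5n n → ℝ) :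
    𝔼 x, (condAvg B' f x - condAvg B f x) ^ 2 = factorEnergy B' f - factorEnergy B f := by
  have h1 := expect_condAvg_mul_real B f (u := condAvg B f) fun x y h => condAvg_eq_of_rel B f h
  have h2 := expect_condAvg_mul_real B' f (u := condAvg B f)
    fun x y h => condAvg_eq_of_rel B f (hB h)
  have h3 : ∀ x, (condAvg B' f x - condAvg B f x) ^ 2 =
      condAvg B' f x ^ 2 - 2 * (condAvg B' f x * condAvg B f x) +
        condAvg B f x * condAvg B f x := fun x => by ring
  simp only [h3, Finset.expect_add_distrib, Finset.expect_sub_distrib, ← Finset.mul_expect, h1, h2,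
    factorEnergy]
  have h4 : 𝔼 x, condAvg B f x ^ 2 = 𝔼 x, f x * condAvg B f x := by rw [← h1]; simp only [sq]
  rw [h4]
  ring

theorem factorEnergy_mono {B B' : Setoid (F5n n)} (hB : B' ≤ B) (f : F5n n → ℝ) :
    factorEnergy B f ≤ factorEnergy B' f := by
  have h1 := expect_condAvg_sub_sq hB f
  have h2 : 0 ≤ 𝔼 x, (condAvg B' f x - condAvg B f x) ^ 2 :=
    Finset.expect_nonneg fun _ _ => sq_nonneg _
  linarith

/-- Correlation with a measurable function forces an energy increment. -/
theorem norm_expect_sq_le_factorEnergy_sub {B B' : Setoid (F5n n)} (hB : B' ≤ B) (f : F5n n → ℝ)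
    {u : F5n n → ℂ} (hu1 : ∀ x, ‖u x‖ ≤ 1) (hu : ∀ x y, B' x y → u x = u y) :
    ‖𝔼 x, ((f x - condAvg B f x : ℝ) : ℂ) * u x‖ ^ 2 ≤ factorEnergy B' f - factorEnergy B f := by
  -- Since u is measurable for B', f may be replaced by its projection to B'; Cauchy–Schwarz and
  -- Pythagoras finish.
  have h1 : 𝔼 x, ((f x - condAvg B f x : ℝ) : ℂ) * u x =
      𝔼 x, u x * ((condAvg B' f x - condAvg B f x : ℝ) : ℂ) := by
    push_cast
    simp only [sub_mul, mul_sub, Finset.expect_sub_distrib]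
    rw [← expect_condAvg_mul B' f hu]
    simp only [mul_comm]
  rw [h1, ← expect_condAvg_sub_sq hB]
  refine (norm_expect_mul_sq_le hu1 _).trans (le_of_eq ?_)
  simp only [Complex.norm_real, Real.norm_eq_abs, sq_abs]

end CondAvg

/-! ### Refinement and rank of quadratic factors -/

namespace QuadraticFactor

variable {n d₁ d₂ e₁ e₂ k₁ k₂ : ℕ}

theorem Refines.rfl {Q : QuadraticFactor n d₁ d₂} : Q.Refines Q := ⟨le_rfl, le_rfl⟩

theorem Refines.trans {Q : QuadraticFactor n d₁ d₂} {Q' : QuadraticFactor n e₁ e₂}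
    {Q'' : QuadraticFactor n k₁ k₂} (h : Q.Refines Q') (h' : Q'.Refines Q'') : Q.Refines Q'' :=
  ⟨h.1.trans h'.1, h.2.trans h'.2⟩

theorem B₁_rel (Q : QuadraticFactor n d₁ d₂) {x y : F5n n} :
    Q.B₁ x y ↔ ∀ j, Q.r j ⬝ᵥ x = Q.r j ⬝ᵥ y := by
  change Q.linMap x = Q.linMap y ↔ _
  simp only [funext_iff, linMap]

theorem B₂_rel (Q : QuadraticFactor n d₁ d₂) {x y : F5n n} :
    Q.B₂ x y ↔ (∀ j, Q.r j ⬝ᵥ x = Q.r j ⬝ᵥ y) ∧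
      ∀ j, x ⬝ᵥ (Q.M j).mulVec x = y ⬝ᵥ (Q.M j).mulVec y := by
  change (Q.linMap x, Q.quadMap x) = (Q.linMap y, Q.quadMap y) ↔ _
  simp only [Prod.mk.injEq, funext_iff, linMap, quadMap]

/-- The factor obtained by adding one vector and one matrix. -/
def extend (Q : QuadraticFactor n d₁ d₂) (r : F5n n) (M : Matrix (Fin n) (Fin n) (ZMod 5))
    (hM : M.IsSymm) : QuadraticFactor n (d₁ + 1) (d₂ + 1) where
  r := Fin.snoc Q.r r
  M := Fin.snoc Q.M M
  symm := by
    intro j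
    refine Fin.lastCases ?_ (fun i => ?_) j
    · simpa using hM
    · simpa using Q.symm i

theorem extend_rel (Q : QuadraticFactor n d₁ d₂) {r : F5n n}
    {M : Matrix (Fin n) (Fin n) (ZMod 5)} {hM : M.IsSymm} {x y : F5n n}
    (h : (Q.extend r M hM).B₂ x y) :
    r ⬝ᵥ x = r ⬝ᵥ y ∧ x ⬝ᵥ M.mulVec x = y ⬝ᵥ M.mulVec y := by
  rw [B₂_rel] at h
  have h1 := h.1 (Fin.last _)
  have h2 := h.2 (Fin.last _)
  simp only [extend, Fin.snoc_last] at h1 h2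
  exact ⟨h1, h2⟩

theorem extend_refines (Q : QuadraticFactor n d₁ d₂) (r : F5n n)
    (M : Matrix (Fin n) (Fin n) (ZMod 5)) (hM : M.IsSymm) : (Q.extend r M hM).Refines Q := by
  constructor
  · intro x y h
    rw [B₁_rel] at h ⊢
    intro j
    simpa [extend] using h j.castSucc
  · intro x y h
    rw [B₂_rel] at h ⊢
    exact ⟨fun j => by simpa [extend] using h.1 j.castSucc,
      fun j => by simpa [extend] using h.2 j.castSucc⟩

/-- If a combination of the matrices has small rank, then one of the matrices can be traded for
that many linear forms. -/
theorem exists_refines_of_combination (Q : QuadraticFactor n d₁ (d₂ + 1))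
    {c : Fin (d₂ + 1) → ZMod 5} (hc : c ≠ 0) :
    ∃ k ≤ (∑ j, c j • Q.M j).rank, ∃ Q' : QuadraticFactor n (d₁ + k) d₂, Q'.Refines Q := by
  set S := ∑ j, c j • Q.M j with hS
  have hSs : S.IsSymm := by
    rw [hS, Matrix.IsSymm, Matrix.transpose_sum]
    exact Finset.sum_congr rfl fun j _ => by rw [Matrix.transpose_smul, (Q.symm j).eq]
  -- A basis of the row space of S supplies the new vectors: their values determine Sx, hence xᵀSx,
  -- and the form of the removed matrix is recovered because its coefficient is nonzero.
  let W := Submodule.span (ZMod 5) (Set.range S.row)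
  let b := Module.finBasis (ZMod 5) W
  obtain ⟨j₀, hj₀⟩ := Function.ne_iff.1 hc
  refine ⟨Module.finrank (ZMod 5) W, S.rank_eq_finrank_span_row.ge,
    ⟨Fin.append Q.r fun i => (b i : F5n n), fun i => Q.M (j₀.succAbove i), fun i => Q.symm _⟩, ?_⟩
  have hr : ∀ (r : Fin d₁ → F5n n) {x y : F5n n},
      (∀ j, Fin.append r (fun i => (b i : F5n n)) j ⬝ᵥ x =
        Fin.append r (fun i => (b i : F5n n)) j ⬝ᵥ y) →
      (∀ j, r j ⬝ᵥ x = r j ⬝ᵥ y) ∧ ∀ i, (b i : F5n n) ⬝ᵥ x = (b i : F5n n) ⬝ᵥ y := by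
    intro r x y h
    refine ⟨fun j => ?_, fun i => ?_⟩
    · simpa only [Fin.append_left] using h (Fin.castAdd _ j)
    · simpa only [Fin.append_right] using h (Fin.natAdd _ i)
  constructor
  · intro x y h
    rw [B₁_rel] at h ⊢
    exact (hr Q.r h).1
  · intro x y h
    rw [B₂_rel] at h ⊢
    obtain ⟨h1, h2⟩ := h
    obtain ⟨h1, hb⟩ := hr Q.r h1
    refine ⟨h1, ?_⟩
    have hS0 : S.mulVec (x - y) = 0 := by
      let l : W →ₗ[ZMod 5] ZMod 5 :=
        { toFun := fun w => (w : F5n n) ⬝ᵥ (x - y)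
          map_add' := fun v w => add_dotProduct _ _ _
          map_smul' := fun a w => smul_dotProduct _ _ _ }
      have hl : l = 0 := b.ext fun i => by
        change (b i : F5n n) ⬝ᵥ (x - y) = 0
        rw [dotProduct_sub, hb, sub_self]
      ext i
      exact LinearMap.congr_fun hl ⟨S.row i, Submodule.subset_span ⟨i, rfl⟩⟩
    have hSq : x ⬝ᵥ S.mulVec x = y ⬝ᵥ S.mulVec y := by
      have e1 : S.mulVec x = S.mulVec y := by
        rw [Matrix.mulVec_sub, sub_eq_zero] at hS0
        exact hS0
      have e2 : ∀ z w, z ⬝ᵥ S.mulVec w = w ⬝ᵥ S.mulVec z := by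
        intro z w
        rw [Matrix.dotProduct_mulVec, ← Matrix.mulVec_transpose, hSs.eq, dotProduct_comm]
      rw [e1, e2, e1]
    have hexp : ∀ z : F5n n, z ⬝ᵥ S.mulVec z = c j₀ * (z ⬝ᵥ (Q.M j₀).mulVec z) +
        ∑ i, c (j₀.succAbove i) * (z ⬝ᵥ (Q.M (j₀.succAbove i)).mulVec z) := by
      intro z
      rw [hS, Matrix.sum_mulVec, dotProduct_sum, Fin.sum_univ_succAbove _ j₀]
      simp only [Matrix.smul_mulVec, dotProduct_smul, smul_eq_mul]
    rw [hexp, hexp] at hSq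
    simp only [h2, add_left_inj] at hSq
    have hj : x ⬝ᵥ (Q.M j₀).mulVec x = y ⬝ᵥ (Q.M j₀).mulVec y :=
      mul_left_cancel₀ hj₀ hSq
    intro j
    rcases Fin.eq_self_or_eq_succAbove j₀ j with rfl | ⟨i, rfl⟩
    · exact hj
    · exact h2 i

/-- Every factor can be refined to one of high rank with bounded complexity. -/
theorem exists_refines_rankAtLeast (ω : ℝ≥0 → ℝ) (d₂ : ℕ) : ∀ d₁ : ℕ, ∃ D : ℕ,
    ∀ (n : ℕ) (Q : QuadraticFactor n d₁ d₂), ∃ (e₁ e₂ : ℕ) (Q' : QuadraticFactor n e₁ e₂),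
      Q'.Refines Q ∧ e₁ ≤ D ∧ e₂ ≤ D ∧ Q'.RankAtLeast (ω ((e₁ + e₂ : ℕ) : ℝ≥0)) := by
  induction d₂ with
  | zero =>
    intro d₁
    refine ⟨d₁, fun n Q => ⟨d₁, 0, Q, Refines.rfl, le_rfl, Nat.zero_le _, fun c hc => ?_⟩⟩
    exact absurd (Subsingleton.elim c 0) hc
  | succ d₂ ih =>
    intro d₁
    choose D hD using ih
    set t := ω ((d₁ + (d₂ + 1) : ℕ) : ℝ≥0) with ht
    -- Induction on the number of matrices: failure of rank t costs one matrix and adds at most ⌈t⌉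
    -- vectors. The supremum covers every possible number added, so no monotonicity of ω is needed.
    refine ⟨d₁ + d₂ + 1 + (Finset.range (⌈t⌉₊ + 1)).sup fun k => D (d₁ + k), fun n Q => ?_⟩
    by_cases hQ : Q.RankAtLeast t
    · exact ⟨d₁, d₂ + 1, Q, Refines.rfl, by omega, by omega, hQ⟩
    · simp only [RankAtLeast, not_forall, not_le] at hQ
      obtain ⟨c, hc, hct⟩ := hQ
      obtain ⟨k, hk, Q', hQ'⟩ := Q.exists_refines_of_combination hc
      obtain ⟨e₁, e₂, Q'', h1, h2, h3, h4⟩ := hD (d₁ + k) n Q'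
      have hkt : k < ⌈t⌉₊ + 1 := by
        have : (k : ℝ) ≤ ⌈t⌉₊ := (Nat.cast_le.2 hk).trans (hct.le.trans (Nat.le_ceil t))
        have : k ≤ ⌈t⌉₊ := by exact_mod_cast this
        omega
      have hle : D (d₁ + k) ≤ (Finset.range (⌈t⌉₊ + 1)).sup fun k => D (d₁ + k) :=
        Finset.le_sup (f := fun k => D (d₁ + k)) (Finset.mem_range.2 hkt)
      exact ⟨e₁, e₂, Q'', h1.trans hQ', by omega, by omega, h4⟩

end QuadraticFactor

/-! ### Energy increment and the regularity lemma -/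

section Regularity

theorem gowersU3Pow_const_mul {n : ℕ} (c : ℝ) (f : F5n n → ℝ) :
    gowersU3Pow (fun x => c * f x) = c ^ 8 * gowersU3Pow f := by
  simp only [gowersU3Pow, Finset.mul_expect]
  refine Finset.expect_congr rfl fun x _ => Finset.expect_congr rfl fun h _ =>
      Finset.expect_congr rfl fun k _ => Finset.expect_congr rfl fun l _ => ?_
  ring

/-- If a function is not `U³`-close to its projection, then the factor can be refined so that
the energy increases. -/
theorem exists_energy_increment {ε : ℝ} (hε : 0 < ε) : ∃ c : ℝ, 0 < c ∧
    ∀ (n d₁ d₂ : ℕ) (f : F5n n → ℝ) (Q : QuadraticFactor n d₁ d₂), (∀ x, |f x| ≤ 1) →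
      ε < gowersU3Norm (f - condAvg Q.B₂ f) →
      ∃ Q' : QuadraticFactor n (d₁ + 1) (d₂ + 1), Q'.Refines Q ∧
        factorEnergy Q.B₂ f + c ≤ factorEnergy Q'.B₂ f := by
  -- The difference f - 𝔼(f | B₂) is bounded only by 2; halving it makes it admissible and turns ε⁸
  -- into (ε/2)⁸.
  obtain ⟨c, hc0, hc⟩ := inverse_gowersU3 (η := (1 / 2) ^ 8 * ε ^ 8) (by positivity)
  refine ⟨(2 * c) ^ 2, by positivity, ?_⟩
  intro n d₁ d₂ f Q hf hQ
  set g := f - condAvg Q.B₂ f with hg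
  have hg8 : ε ^ 8 ≤ gowersU3Pow g := by
    have h1 : gowersU3Norm g ^ 8 = gowersU3Pow g := by
      rw [gowersU3Norm, ← Real.rpow_natCast, ← Real.rpow_mul (gowersU3Pow_nonneg g)]
      norm_num
    rw [← h1]
    exact pow_le_pow_left₀ hε.le hQ.le 8
  obtain ⟨M, r, hM, hMr⟩ := hc n (fun x => 1 / 2 * g x) (fun x => by
    have h1 := abs_sub (f x) (condAvg Q.B₂ f x)
    have h2 := abs_condAvg_le_one Q.B₂ hf x
    have h3 := hf x
    rw [abs_mul, abs_of_pos (by norm_num : (0 : ℝ) < 1 / 2)]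
    simp only [hg, Pi.sub_apply]
    linarith) (by
    rw [gowersU3Pow_const_mul]
    gcongr)
  refine ⟨Q.extend r M hM, Q.extend_refines r M hM, ?_⟩
  have h1 := norm_expect_sq_le_factorEnergy_sub (Q.extend_refines r M hM).2 f
    (u := fun x => ec (x ⬝ᵥ M.mulVec x + r ⬝ᵥ x)) (fun x => (norm_ec _).le) fun x y h => by
      obtain ⟨e1, e2⟩ := Q.extend_rel h
      rw [e1, e2]
  have h2 : 𝔼 x, ((1 / 2 * g x : ℝ) : ℂ) * ec (x ⬝ᵥ M.mulVec x + r ⬝ᵥ x) =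
      1 / 2 * 𝔼 x, ((f x - condAvg Q.B₂ f x : ℝ) : ℂ) * ec (x ⬝ᵥ M.mulVec x + r ⬝ᵥ x) := by
    rw [Finset.mul_expect]
    refine Finset.expect_congr rfl fun x _ => ?_
    simp only [hg, Pi.sub_apply]
    push_cast
    ring
  rw [h2, norm_mul] at hMr
  have h3 : 2 * c ≤ ‖𝔼 x, ((f x - condAvg Q.B₂ f x : ℝ) : ℂ) *
      ec (x ⬝ᵥ M.mulVec x + r ⬝ᵥ x)‖ := by
    have : ‖(1 / 2 : ℂ)‖ = 1 / 2 := by norm_num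
    rw [this] at hMr
    linarith
  have h4 := pow_le_pow_left₀ (by positivity) h3 2
  linarith

/-- The weak (Koopman–von Neumann) regularity lemma for the `U³` norm. -/
theorem exists_refines_gowersU3Norm_le {ε : ℝ} (hε : 0 < ε) : ∃ K : ℕ,
    ∀ (n d₁ d₂ : ℕ) (f : F5n n → ℝ) (Q : QuadraticFactor n d₁ d₂), (∀ x, |f x| ≤ 1) →
      ∃ k ≤ K, ∃ Q' : QuadraticFactor n (d₁ + k) (d₂ + k), Q'.Refines Q ∧
        gowersU3Norm (f - condAvg Q'.B₂ f) ≤ ε := by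
  obtain ⟨c, hc0, hc⟩ := exists_energy_increment hε
  obtain ⟨K, hK⟩ := exists_nat_gt (1 / c)
  refine ⟨K, fun n d₁ d₂ f Q hf => ?_⟩
  by_contra! hcon
  have key : ∀ m ≤ K, ∃ Q' : QuadraticFactor n (d₁ + m) (d₂ + m), Q'.Refines Q ∧
      m * c ≤ factorEnergy Q'.B₂ f := by
    intro m
    induction m with
    | zero =>
      intro _
      exact ⟨Q, QuadraticFactor.Refines.rfl, by simpa using factorEnergy_nonneg Q.B₂ f⟩
    | succ m ih =>
      intro hm
      obtain ⟨Q', h1, h2⟩ := ih (by omega)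
      obtain ⟨Q'', h3, h4⟩ := hc n _ _ f Q' hf (hcon m (by omega) Q' h1)
      refine ⟨Q'', h3.trans h1, ?_⟩
      push_cast
      linarith
  obtain ⟨Q', -, h⟩ := key K le_rfl
  have h1 := factorEnergy_le_one Q'.B₂ hf
  rw [div_lt_iff₀ hc0] at hK
  linarith

/-- The energy increment argument, starting from a factor of high rank whose energy is at most
`m δ²` away from `1`. -/
theorem exists_regular_refinement {δ : ℝ} (hδ : 0 < δ) (ω₁ ω₂ : ℝ≥0 → ℝ) (hω₂ : ∀ t, 0 < ω₂ t)
    (m : ℕ) : ∀ d₁ d₂ : ℕ, ∃ C : ℕ, ∀ (n : ℕ) (f : F5n n → ℝ), (∀ x, |f x| ≤ 1) →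
      ∀ Q₀ : QuadraticFactor n d₁ d₂, Q₀.RankAtLeast (ω₁ ((d₁ + d₂ : ℕ) : ℝ≥0)) →
      1 - m * δ ^ 2 < factorEnergy Q₀.B₂ f →
      ∃ (e₁ e₂ : ℕ) (Q : QuadraticFactor n e₁ e₂), Q.Refines Q₀ ∧ e₁ ≤ C ∧ e₂ ≤ C ∧
        Q.RankAtLeast (ω₁ ((e₁ + e₂ : ℕ) : ℝ≥0)) ∧
        ∃ f₁ f₂ f₃ : F5n n → ℝ, f = f₁ + f₂ + f₃ ∧ f₁ = condAvg Q.B₂ f ∧ l2Norm f₂ ≤ δ ∧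
          gowersU3Norm f₃ ≤ 1 / ω₂ ((e₁ + e₂ : ℕ) : ℝ≥0) := by
  induction m with
  | zero =>
    intro d₁ d₂
    -- With m = 0 the energy would exceed 1, so any bound will do.
    refine ⟨0, fun n f hf Q₀ _ hE => ?_⟩
    have := factorEnergy_le_one Q₀.B₂ hf
    simp only [Nat.cast_zero, zero_mul, sub_zero] at hE
    linarith
  | succ m ih =>
    intro d₁ d₂
    choose C hC using ih
    choose D hD using QuadraticFactor.exists_refines_rankAtLeast ω₁
    -- The tolerance uses the complexity of Q₀, not of the refinement, because Q₀ is the factor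
    -- returned when the projections are close.
    obtain ⟨K, hK⟩ := exists_refines_gowersU3Norm_le
      (one_div_pos.2 (hω₂ ((d₁ + d₂ : ℕ) : ℝ≥0)))
    set D' := (Finset.range (K + 1)).sup fun k => D (d₂ + k) (d₁ + k) with hD'
    set C' := (Finset.range (D' + 1) ×ˢ Finset.range (D' + 1)).sup fun p => C p.1 p.2 with hC'
    refine ⟨d₁ + d₂ + C', fun n f hf Q₀ hQ₀ hE => ?_⟩
    obtain ⟨k, hk, Q', hQ', hU⟩ := hK n d₁ d₂ f Q₀ hf
    by_cases hl : l2Norm (condAvg Q'.B₂ f - condAvg Q₀.B₂ f) ≤ δ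
    · exact ⟨d₁, d₂, Q₀, QuadraticFactor.Refines.rfl, by omega, by omega, hQ₀, condAvg Q₀.B₂ f,
        condAvg Q'.B₂ f - condAvg Q₀.B₂ f, f - condAvg Q'.B₂ f, by abel, rfl, hl, hU⟩
    · have h1 : δ ^ 2 < factorEnergy Q'.B₂ f - factorEnergy Q₀.B₂ f := by
        rw [← expect_condAvg_sub_sq hQ'.2]
        exact (Real.lt_sqrt hδ.le).1 (not_le.1 hl)
      obtain ⟨a₁, a₂, Q'', h2, h3, h4, h5⟩ := hD (d₂ + k) (d₁ + k) n Q'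
      have h6 := factorEnergy_mono h2.2 f
      have hDle : D (d₂ + k) (d₁ + k) ≤ D' :=
        Finset.le_sup (f := fun k => D (d₂ + k) (d₁ + k)) (Finset.mem_range.2 (by omega))
      have hCle : C a₁ a₂ ≤ C' := Finset.le_sup (f := fun p : ℕ × ℕ => C p.1 p.2) (b := (a₁, a₂))
        (Finset.mem_product.2 ⟨Finset.mem_range.2 (by omega), Finset.mem_range.2 (by omega)⟩)
      -- The energy gained, more than δ², pays for lowering m by one.
      obtain ⟨e₁, e₂, Q, h7, h8, h9, h10⟩ := hC a₁ a₂ n f hf Q'' h5 (by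
        push_cast at hE
        linarith)
      exact ⟨e₁, e₂, Q, h7.trans (h2.trans hQ'), by omega, by omega, h10⟩

end Regularity

end

theorem mainTheorem3 (δ : ℝ) (hδ : 0 < δ) (ω₁ ω₂ : ℝ≥0 → ℝ)
    (hω₁ : ∀ t, 0 < ω₁ t) (hω₂ : ∀ t, 0 < ω₂ t) :
    ∃ (n₀ : ℕ) (C : ℕ → ℕ → ℕ), ∀ n : ℕ, n₀ < n →
      ∀ f : F5n n → ℝ, (∀ x, f x ∈ Set.Icc (-1 : ℝ) 1) →
      ∀ (e₁ e₂ : ℕ) (Q₀ : QuadraticFactor n e₁ e₂),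
      ∃ (d₁ d₂ : ℕ) (Q : QuadraticFactor n d₁ d₂),
        Q.Refines Q₀ ∧
        d₁ ≤ C e₁ e₂ ∧ d₂ ≤ C e₁ e₂ ∧
        Q.RankAtLeast (ω₁ ((d₁ + d₂ : ℕ) : ℝ≥0)) ∧
        ∃ f₁ f₂ f₃ : F5n n → ℝ,
          f = f₁ + f₂ + f₃ ∧
          f₁ = condAvg Q.B₂ f ∧
          l2Norm f₂ ≤ δ ∧
          gowersU3Norm f₃ ≤ 1 / ω₂ ((d₁ + d₂ : ℕ) : ℝ≥0) := by
  -- This makes 1 - mδ² negative, so the induction can start from any factor of sufficient rank.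
  obtain ⟨m, hm⟩ := exists_nat_gt (1 / δ ^ 2)
  choose C hC using exists_regular_refinement hδ ω₁ ω₂ hω₂ m
  choose D hD using QuadraticFactor.exists_refines_rankAtLeast ω₁
  -- All bounds are uniform in n, so n₀ = 0 works. `D` takes the number of matrices as its first
  -- argument.
  refine ⟨0, fun e₁ e₂ => (Finset.range (D e₂ e₁ + 1) ×ˢ Finset.range (D e₂ e₁ + 1)).sup
    fun p => C p.1 p.2, fun n _ f hf e₁ e₂ Q₀ => ?_⟩
  obtain ⟨a₁, a₂, Q', h1, h2, h3, h4⟩ := hD e₂ e₁ n Q₀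
  have hCle : C a₁ a₂ ≤ (Finset.range (D e₂ e₁ + 1) ×ˢ Finset.range (D e₂ e₁ + 1)).sup
      fun p => C p.1 p.2 := Finset.le_sup (f := fun p : ℕ × ℕ => C p.1 p.2) (b := (a₁, a₂))
    (Finset.mem_product.2 ⟨Finset.mem_range.2 (by omega), Finset.mem_range.2 (by omega)⟩)
  obtain ⟨d₁, d₂, Q, h5, h6, h7, h8⟩ := hC a₁ a₂ n f (fun x => abs_le.2 (hf x)) Q' h4 (by
    have := factorEnergy_nonneg Q'.B₂ f
    rw [div_lt_iff₀ (by positivity)] at hm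
    linarith)
  exact ⟨d₁, d₂, Q, h5.trans h1, h6.trans hCle, h7.trans hCle, h8⟩
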